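/- **Setting.** Let $n>0$. In the Gaussian white noise model one observes the path $Y=(Y_x)_{x\in[0,1]}$, $$Y_x=\int_0^x f(u)\,du+n^{-1/2}W_x ,$$ where $W$ is a standard Brownian motion and $f:[0,1]\to\mathbb R$ is unknown; $P_f$ is the distribution of $Y$, with expectation $E_f$ and variance $\operatorname{Var}_f$. For $\beta>0$ let $m$ be the largest integer strictly smaller than $\beta$ and, for $D\subseteq\mathbb R$, let $$\|f\|_{\mathscr C^\beta(D)}=\sum_{\ell\le m}\sup_D|f^{(\ell)}|+\sup_{x,y\in D,\,x\ne y}\frac{|f^{(m)}(x)-f^{(m)}(y)|}{|x-y|^{\beta-m}}$$ ($=\infty$ if $f$ is not $m$ times differentiable on $D$). Let $\mathscr C^\beta(R)=\{f:[0,1]\to\mathbb R:\|f\|_{\mathscr C^\beta([0,1])}\le R\}$, $\mathscr C^\beta(\mathbb R)=\{K:\mathbb R\to\mathbb R:\|K\|_{\mathscr C^\beta(\mathbb R)}<\infty\}$, and $\|K\|_2=\|K\|_{L^2(\mathbb R)}$ (with $\|K\|_2^{-1}=0$ if $\|K\|_2=\infty$; such $K$ contribute $0$ below). With $(x)_+=\max(x,0)$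 define $$\gamma(R,\beta)=\sup_{K\in\mathscr C^\beta(\mathbb R):\,K(0)=1}\Big(\|K\|_2^{-1}\Big(1-\frac{\|K\|_{\mathscr C^\beta(\mathbb R)}}{R}\Big)_+\Big)^2,$$ and, for $C>0$ and $0\le a<R$, $$\overline\gamma(R,\beta,C,a)=\sup_{K\in\mathscr C^\beta(\mathbb R):\,K(0)=1}\Big(\|K\|_2^{-1}\Big(1-\frac{\|K\|_{\mathscr C^\beta(\mathbb R)}}{R-a}\Big)_+\Big)^2\exp\Big(-C(R-a)^2\frac{\|K\|_2^2}{\|K\|_{\mathscr C^\beta(\mathbb R)}^2}\Big),$$ and $\overline\gamma(R,\beta,C,R)=0$. Fix $x_0\in[0,1]$. An estimator $\widehat f(x_0)$ is a measurable real-valued function of $Y$ for which $E_f[\widehat f(x_0)]$ exists and is finite for all $f\in\mathscr C^\beta(R)$; $\operatorname{Bias}_f(\widehat f(x_0))=E_f[\widehat f(x_0)]-f(x_0)$, and $\operatorname{Var}_f(\widehat f(x_0))=+\infty$ if $\widehat f(x_0)$ is not square integrable under $P_f$. For a measurable function $\widehat f(x_0)$ of $Y$, $\operatorname{MSE}_f(\widehat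 f(x_0))=E_f[(\widehat f(x_0)-f(x_0))^2]\in[0,\infty]$. Conventions: $(+\infty)\cdot 0=+\infty$, and $v/0=+\infty$ for every $v\in[0,\infty]$, including $v=0$. **Theorem.** Let $\beta,R>0$ and $x_0\in[0,1]$. (i) For every $n>0$, with $\mathcal T=\{\widehat f:\sup_{f\in\mathscr C^\beta(R)}|\operatorname{Bias}_f(\widehat f(x_0))|<1\}$, $$\inf_{\widehat f\in\mathcal T}\ \sup_{f\in\mathscr C^\beta(R)}|\operatorname{Bias}_f(\widehat f(x_0))|^{1/\beta}\ \sup_{f\in\mathscr C^\beta(R)}\operatorname{Var}_f(\widehat f(x_0))\ \ge\ \frac{\gamma(R,\beta)}{n}.$$ (ii) For every $n>0$ and $C>0$, with $\mathcal S(C)=\{\widehat f:\sup_{f\in\mathscr C^\beta(R)}|\operatorname{Bias}_f(\widehat f(x_0))|<(C/n)^{\beta/(2\beta+1)}\}\cap\mathcal T$, $$\inf_{\widehat f\in\mathcal S(C)}\ \sup_{f\in\mathscr C^\beta(R)}|\operatorname{Bias}_f(\widehat f(x_0))|^{1/\beta}\ \inf_{f\in\mathscr C^\beta(R)}\frac{\operatorname{Var}_f(\widehat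 f(x_0))}{\overline\gamma(R,\beta,C,\|f\|_{\mathscr C^\beta([0,1])})}\ \ge\ \frac1n.$$ **Corollary.** (iii) For every $n>0$, with the infimum over all measurable real-valued functions $\widehat f(x_0)$ of $Y$, $$\inf_{\widehat f}\ \sup_{f\in\mathscr C^\beta(R)}\operatorname{MSE}_f(\widehat f(x_0))\ \ge\ \Big(\frac{\gamma(R,\beta)}n\Big)^{2\beta/(2\beta+1)}\wedge 1 .$$ (iv) The rate $n^{-2\beta/(2\beta+1)}$ is only attained by balancing worst-case squared bias and worst-case variance: for every $A>0$ there are $c,n_0>0$ such that for all $n\ge n_0$ and every measurable $\widehat f(x_0)$ with $\sup_{f\in\mathscr C^\beta(R)}\operatorname{MSE}_f(\widehat f(x_0))\le A\,n^{-2\beta/(2\beta+1)}$, both $\big(\sup_{f\in\mathscr C^\beta(R)}|\operatorname{Bias}_f(\widehat f(x_0))|\big)^2$ and $\sup_{f\in\mathscr C^\beta(R)}\operatorname{Var}_f(\widehat f(x_0))$ are at least $c\,n^{-2\beta/(2\beta+1)}$. -/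

import Mathlib

open MeasureTheory ProbabilityTheory Set Filter
open scoped ENNReal NNReal Topology unitInterval

noncomputable section

namespace WhiteNoise

/-! ### Hölder norms -/

/-- The largest natural number that is strictly smaller than `β` (for `β > 0`). -/
def strictFloor (β : ℝ) : ℕ := ⌈β⌉₊ - 1

open Classical in
/-- The `β`-Hölder norm of `f` on the domain `D`, with values in `[0, ∞]`:
`∑_{ℓ ≤ m} sup_D |f^(ℓ)| + sup_{x ≠ y ∈ D} |f^(m) x - f^(m) y| / |x - y|^(β - m)`, where `m` is the
largest integer strictly smaller than `β`. Only the values of `f` on `D` matter (for `D = [0,1]`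
the derivatives at the end points are one-sided). A function that is not `m` times differentiable
on `D` has norm `∞`; continuity of the `m`-th derivative is no further restriction, because
it follows from the finiteness of the last supremum. -/
def holderNorm (D : Set ℝ) (β : ℝ) (f : ℝ → ℝ) : ℝ≥0∞ :=
  if ContDiffOn ℝ (strictFloor β : ℕ) f D then
    (∑ l ∈ Finset.range (strictFloor β + 1), ⨆ x ∈ D, ‖iteratedDerivWithin l f D x‖ₑ) +
      ⨆ x ∈ D, ⨆ y ∈ D, ⨆ _ : x ≠ y,
        ‖iteratedDerivWithin (strictFloor β) f D x - iteratedDerivWithin (strictFloor β) f D y‖ₑ /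
          ENNReal.ofReal (|x - y| ^ (β - strictFloor β))
  else ∞

/-- The Hölder ball of radius `R` on `[0,1]`. Its members are functions on `[0,1]`, represented
by functions on `ℝ` whose values outside `[0,1]` play no role. -/
def holderBall (β R : ℝ) : Set (ℝ → ℝ) :=
  {f | holderNorm (Icc 0 1) β f ≤ ENNReal.ofReal R}

/-- The kernels over which the suprema in the constants are taken: functions on `ℝ` with finite
`β`-Hölder norm and value `1` at `0`. -/
def kernels (β : ℝ) : Set (ℝ → ℝ) :=
  {K | holderNorm univ β K < ∞ ∧ K 0 = 1}

/-! ### The constants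

Subtraction on `[0, ∞]` is truncated at zero, which is the positive part. A kernel that is not
square integrable has `‖K‖₂⁻¹ = 0`. -/

/-- The constant `γ(R, β)`. -/
def gamma (R β : ℝ) : ℝ≥0∞ :=
  ⨆ K ∈ kernels β,
    ((eLpNorm K 2 volume)⁻¹ * (1 - holderNorm univ β K / ENNReal.ofReal R)) ^ 2

/-- The constant `γ̄(R, β, C, a)` for `0 ≤ a < R`. For `a = R` this gives the value `0`, since
`‖K‖ / 0 = ∞` for a kernel `K`. -/
def gammaBar (R β C a : ℝ) : ℝ≥0∞ :=
  ⨆ K ∈ kernels β,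
    ((eLpNorm K 2 volume)⁻¹ * (1 - holderNorm univ β K / ENNReal.ofReal (R - a))) ^ 2 *
      ENNReal.ofReal (Real.exp (-(C * (R - a) ^ 2 *
        ((eLpNorm K 2 volume).toReal ^ 2 / (holderNorm univ β K).toReal ^ 2))))

/-! ### Arithmetic conventions on `[0, ∞]` -/

open Classical in
/-- Multiplication on `[0, ∞]` with `∞ · 0 = ∞`. -/
def mulTop (a b : ℝ≥0∞) : ℝ≥0∞ := if a = ∞ ∨ b = ∞ then ∞ else a * b

open Classical in
/-- Division on `[0, ∞]` with `a / 0 = ∞` for every `a` (also for `a = 0`). -/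
def divTop (a b : ℝ≥0∞) : ℝ≥0∞ := if b = 0 then ∞ else a / b

/-! ### The Gaussian white noise model -/

section Model

variable {Ω : Type*} [MeasurableSpace Ω]

/-- The observed path `Y_x = ∫₀ˣ f(u) du + n^(-1/2) W_x`, `x ∈ [0,1]`. -/
def observation (W : ℝ≥0 → Ω → ℝ) (n : ℝ) (f : ℝ → ℝ) (ω : Ω) : I → ℝ :=
  fun x => (∫ u in (0 : ℝ)..x, f u) + n ^ (-(1 / 2) : ℝ) * W (unitInterval.toNNReal x) ω

/-- The distribution `P_f` of the observed path, on the path space with the product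
`σ`-algebra (on continuous paths this is the Borel `σ`-algebra of the supremum norm). -/
def law (P : Measure Ω) (W : ℝ≥0 → Ω → ℝ) (n : ℝ) (f : ℝ → ℝ) : Measure (I → ℝ) :=
  P.map (observation W n f)

theorem aemeasurable_observation {P : Measure Ω} {W : ℝ≥0 → Ω → ℝ} (hW : IsBrownianReal W P)
    (n : ℝ) (f : ℝ → ℝ) : AEMeasurable (observation W n f) P := by
  let q : ℕ → ℕ → ℝ≥0 := fun j k => (j : ℝ≥0) / (k + 1)
  let j : ℝ≥0 → ℕ → ℕ := fun t k => ⌊t * (k + 1)⌋₊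
  have hd : ∀ t, Tendsto (fun k => q (j t k) k) atTop (𝓝 t) := fun t => by
    have h := (tendsto_nat_floor_mul_div_atTop (R := ℝ) t.2).comp
      (tendsto_atTop_add_const_right atTop (1 : ℝ) tendsto_natCast_atTop_atTop)
    rw [← NNReal.tendsto_coe]
    refine h.congr fun k => ?_
    simp only [q, j, Function.comp, NNReal.coe_div, NNReal.coe_natCast, NNReal.coe_add,
      NNReal.coe_one]
    congr 2
  let g : ℝ≥0 → Ω → ℝ := fun t => (hW.aemeasurable t).mk
  have hg : ∀ t, Measurable (g t) := fun t => (hW.aemeasurable t).measurable_mk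
  have hae : ∀ᵐ ω ∂P, ∀ a b, W (q a b) ω = g (q a b) ω :=
    ae_all_iff.2 fun a => ae_all_iff.2 fun b => (hW.aemeasurable _).ae_eq_mk
  refine ⟨fun ω x => (∫ u in (0 : ℝ)..x, f u) + n ^ (-(1 / 2) : ℝ) *
    limsup (fun k => g (q (j (unitInterval.toNNReal x) k) k) ω) atTop, ?_, ?_⟩
  · refine measurable_pi_lambda _ fun x => ?_
    exact ((Measurable.limsup fun k => hg _).const_mul _).const_add _
  · filter_upwards [hae, hW.cont] with ω h1 h2
    funext x
    have h3 : Tendsto (fun k => g (q (j (unitInterval.toNNReal x) k) k) ω) atTop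
        (𝓝 (W (unitInterval.toNNReal x) ω)) := by
      simp only [← h1]
      exact (h2.tendsto _).comp (hd _)
    simp only [observation, h3.limsup_eq]

theorem isProbabilityMeasure_law {P : Measure Ω} {W : ℝ≥0 → Ω → ℝ} (hW : IsBrownianReal W P)
    (n : ℝ) (f : ℝ → ℝ) : IsProbabilityMeasure (law P W n f) := by
  have := hW.isGaussianProcess.isProbabilityMeasure
  exact Measure.isProbabilityMeasure_map (aemeasurable_observation hW n f)

/-! ### Estimators of `f x₀`, bias, variance and risk -/

/-- Estimators: measurable functions of the observed path whose expectation exists and is finite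
for every parameter in the Hölder ball. -/
def estimators (P : Measure Ω) (W : ℝ≥0 → Ω → ℝ) (n β R : ℝ) : Set ((I → ℝ) → ℝ) :=
  {T | Measurable T ∧ ∀ f ∈ holderBall β R, Integrable T (law P W n f)}

/-- The absolute bias `|E_f[T] - f x₀|`, as an element of `[0, ∞]`. -/
def absBias (P : Measure Ω) (W : ℝ≥0 → Ω → ℝ) (n x₀ : ℝ) (T : (I → ℝ) → ℝ) (f : ℝ → ℝ) : ℝ≥0∞ :=
  ‖(∫ y, T y ∂(law P W n f)) - f x₀‖ₑ

/-- The variance `Var_f(T)`, equal to `∞` if `T` is not square integrable under `P_f`. -/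
def var (P : Measure Ω) (W : ℝ≥0 → Ω → ℝ) (n : ℝ) (T : (I → ℝ) → ℝ) (f : ℝ → ℝ) : ℝ≥0∞ :=
  eVar[T; law P W n f]

/-- The mean squared error `E_f[(T - f x₀)²]`, with values in `[0, ∞]`. -/
def mse (P : Measure Ω) (W : ℝ≥0 → Ω → ℝ) (n x₀ : ℝ) (T : (I → ℝ) → ℝ) (f : ℝ → ℝ) : ℝ≥0∞ :=
  ∫⁻ y, ‖T y - f x₀‖ₑ ^ 2 ∂(law P W n f)

/-- The class `𝒯` of estimators with worst-case bias smaller than `1`. -/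
def classT (P : Measure Ω) (W : ℝ≥0 → Ω → ℝ) (n β R x₀ : ℝ) : Set ((I → ℝ) → ℝ) :=
  {T ∈ estimators P W n β R | (⨆ f ∈ holderBall β R, absBias P W n x₀ T f) < 1}

/-- The class `𝒮(C)` of those estimators in `𝒯` whose worst-case bias is smaller than
`(C/n)^(β/(2β+1))`. -/
def classS (P : Measure Ω) (W : ℝ≥0 → Ω → ℝ) (n β R x₀ C : ℝ) : Set ((I → ℝ) → ℝ) :=
  {T ∈ estimators P W n β R | (⨆ f ∈ holderBall β R, absBias P W n x₀ T f) <
    ENNReal.ofReal ((C / n) ^ (β / (2 * β + 1)))} ∩ classT P W n β R x₀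

end Model

end WhiteNoise

end

noncomputable section

namespace WhiteNoise

/-! ### Gaussian Hilbert spaces and the Cameron-Martin formula -/

section Hilbert

variable {ι H₁ H₂ : Type*} [NormedAddCommGroup H₁] [InnerProductSpace ℝ H₁] [CompleteSpace H₁]
  [NormedAddCommGroup H₂] [InnerProductSpace ℝ H₂] [CompleteSpace H₂]

/-! Perturb `f` to `f ± k`. The difference of the two likelihood ratios with respect to `P_f` has
second moment `4 sinh v` with `v = n‖k‖²`, so Cauchy-Schwarz under `P_f`, applied to the centred
estimator, gives `(E_{f+k} T - E_{f-k} T)² ≤ Var_f(T) · 4 sinh(n‖k‖²)`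
(`enorm_sq_integral_law_sub_le`). No bound on the variance at `f ± k` enters.

The perturbation is the bump `V h^β K((x - x₀)/h)`. For `h ≤ 1` its Hölder norm on `[0,1]` is at
most `V‖K‖`, so `V = (R - ‖f‖)/‖K‖` keeps `f ± k` in the ball; its squared `L²` norm is at most `V²
h^(2β+1) ‖K‖₂²`. If all biases are at most `h^β`, the two expectations differ by at least `2(V -
1)h^β`. Together with `sinh x ≤ x exp x` this is (ii), the constraint `n h^(2β+1) ≤ C` controlling
the exponential (`gammaBar_le_var_mul`).

In (i) the variance is bounded over the whole ball. The segment from `-k` to `k` can then be cut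
into many short pieces with the two-point inequality applied on each; `q² sinh(a/q²) → a` removes
the exponential in the limit (`sq_le_mul_of_var_le`, `gamma_le_of_var_le`).

The likelihood ratios come from a Cameron-Martin formula proved without a stochastic integral. The
covariance `min(s,t)` is the Gram matrix of the indicators of `(0,s]` in `L²`, so a function has a
counterpart `z` in the Gaussian Hilbert space of `W`, and tilting by `z` shifts `W` by the primitive
of that function.

For (iii) and (iv), both squared bias and variance are at most the mean squared error. In (iii) this
is inserted into (i). In (iv), if one of the two were too small, the one-kernel form of (i) would
fail. -/

open scoped InnerProductSpace in
theorem norm_linearCombination_eq_of_inner_eq {H₁ H₂ : Type*}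
    [NormedAddCommGroup H₁] [InnerProductSpace ℝ H₁]
    [NormedAddCommGroup H₂] [InnerProductSpace ℝ H₂] {u : ι → H₁} {v : ι → H₂}
    (h : ∀ i j, ⟪u i, u j⟫_ℝ = ⟪v i, v j⟫_ℝ) (a : ι →₀ ℝ) :
    ‖Finsupp.linearCombination ℝ u a‖ = ‖Finsupp.linearCombination ℝ v a‖ := by
  have : ‖Finsupp.linearCombination ℝ u a‖ ^ 2 = ‖Finsupp.linearCombination ℝ v a‖ ^ 2 := by
    simp only [← real_inner_self_eq_norm_sq, Finsupp.linearCombination_apply, Finsupp.sum,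
      sum_inner, inner_sum, real_inner_smul_left, real_inner_smul_right, h]
  simpa using this

open scoped InnerProductSpace in
/-- Two families with the same Gram matrix: every vector `x` has a counterpart `z` in the closed
span of the second family, with the same inner products and no larger norm. -/
theorem exists_mem_closure_span_inner_eq {u : ι → H₁} {v : ι → H₂}
    (h : ∀ i j, ⟪u i, u j⟫_ℝ = ⟪v i, v j⟫_ℝ) (x : H₁) :
    ∃ z ∈ (Submodule.span ℝ (range v)).topologicalClosure,
      (∀ i, ⟪v i, z⟫_ℝ = ⟪u i, x⟫_ℝ) ∧ ‖z‖ ≤ ‖x‖ := by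
  let S := (Submodule.span ℝ (range u)).topologicalClosure
  have : CompleteSpace S := (Submodule.isClosed_topologicalClosure _).completeSpace_coe
  -- Only the part of `x` in the closed span of `u` can be transported. The orthogonal part is
  -- invisible to the inner products, and dropping it is what makes the norm bound an inequality.
  let p : H₁ := S.starProjection x
  have hpS : p ∈ closure (Submodule.span ℝ (range u) : Set H₁) := by
    rw [← Submodule.topologicalClosure_coe]
    exact S.starProjection_apply_mem x
  obtain ⟨g, hg, hgp⟩ := mem_closure_iff_seq_limit.1 hpS
  have hga : ∀ k, ∃ a : ι →₀ ℝ, Finsupp.linearCombination ℝ u a = g k := fun k => by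
    have := hg k
    rwa [← Finsupp.range_linearCombination] at this
  choose a ha using hga
  -- Equal Gram matrices give equal norms to combinations with the same coefficients, so the Cauchy
  -- property carries over from `u` to `v`.
  have hcauchy : CauchySeq fun k => Finsupp.linearCombination ℝ v (a k) := by
    have hc := hgp.cauchySeq
    rw [Metric.cauchySeq_iff] at hc ⊢
    intro ε hε
    obtain ⟨N, hN⟩ := hc ε hε
    refine ⟨N, fun m hm k hk => ?_⟩
    have := hN m hm k hk
    rw [dist_eq_norm] at this ⊢
    rwa [← ha, ← ha, ← map_sub, norm_linearCombination_eq_of_inner_eq h, map_sub] at this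
  obtain ⟨z, hz⟩ := cauchySeq_tendsto_of_complete hcauchy
  refine ⟨z, ?_, fun i => ?_, ?_⟩
  · rw [← SetLike.mem_coe, Submodule.topologicalClosure_coe]
    refine mem_closure_of_tendsto hz (Eventually.of_forall fun k => ?_)
    rw [SetLike.mem_coe, ← Finsupp.range_linearCombination]
    exact ⟨_, rfl⟩
  · have h1 : Tendsto (fun k => ⟪v i, Finsupp.linearCombination ℝ v (a k)⟫_ℝ) atTop
        (𝓝 ⟪v i, z⟫_ℝ) := tendsto_const_nhds.inner hz
    have h2 : Tendsto (fun k => ⟪v i, Finsupp.linearCombination ℝ v (a k)⟫_ℝ) atTop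
        (𝓝 ⟪u i, p⟫_ℝ) := by
      refine ((tendsto_const_nhds (x := u i)).inner hgp).congr fun k => ?_
      rw [← ha]
      simp only [Finsupp.linearCombination_apply, Finsupp.sum, inner_sum, real_inner_smul_right, h]
    rw [tendsto_nhds_unique h1 h2]
    have hui : u i ∈ S := Submodule.le_topologicalClosure _ (Submodule.subset_span ⟨i, rfl⟩)
    rw [← S.inner_starProjection_left_eq_right, S.starProjection_eq_self_iff.2 hui]
  · have h1 : Tendsto (fun k => ‖Finsupp.linearCombination ℝ v (a k)‖) atTop (𝓝 ‖p‖) := by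
      refine hgp.norm.congr fun k => ?_
      rw [← ha, norm_linearCombination_eq_of_inner_eq h]
    rw [tendsto_nhds_unique hz.norm h1]
    exact S.norm_starProjection_apply_le x

end Hilbert

theorem coeFn_sum_smul {Ω ι : Type*} [MeasurableSpace Ω] {P : Measure Ω} {X : ι → Ω → ℝ}
    {v : ι → Lp ℝ 2 P} (hv : ∀ i, v i =ᵐ[P] X i) (s : Finset ι) (a : ι → ℝ) :
    (∑ i ∈ s, a i • v i : Lp ℝ 2 P) =ᵐ[P] fun ω => ∑ i ∈ s, a i * X i ω := by
  classical
  induction s using Finset.induction_on with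
  | empty =>
    simp only [Finset.sum_empty]
    exact Lp.coeFn_zero _ _ _
  | insert j s hj ih =>
    simp only [Finset.sum_insert hj]
    filter_upwards [Lp.coeFn_add (a j • v j) (∑ i ∈ s, a i • v i), Lp.coeFn_smul (a j) (v j),
      hv j, ih] with ω h1 h2 h3 h4
    rw [h1, Pi.add_apply, h2, Pi.smul_apply, h3, h4, smul_eq_mul]

section Gaussian

variable {Ω : Type*} [MeasurableSpace Ω] {P : Measure Ω} {ι : Type*}

theorem map_eq_gaussianReal_of_mem_span {X : ι → Ω → ℝ} (hX : IsGaussianProcess X P)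
    (h0 : ∀ i, P[X i] = 0) {v : ι → Lp ℝ 2 P} (hv : ∀ i, v i =ᵐ[P] X i)
    {z : Lp ℝ 2 P} (hz : z ∈ Submodule.span ℝ (range v)) :
    P.map z = gaussianReal 0 (‖z‖₊ ^ 2) := by
  have := hX.isProbabilityMeasure
  rw [← Finsupp.range_linearCombination] at hz
  obtain ⟨a, rfl⟩ := hz
  set z := Finsupp.linearCombination ℝ v a with hzdef
  have h1 : z =ᵐ[P] fun ω => ∑ i ∈ a.support, a i * X i ω := by
    rw [hzdef, Finsupp.linearCombination_apply, Finsupp.sum]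
    exact coeFn_sum_smul hv _ _
  have h2 : HasGaussianLaw z P :=
    HasGaussianLaw.congr (hX.smul a).hasGaussianLaw_fun_sum h1.symm
  have h3 : P[z] = 0 := by
    rw [integral_congr_ae h1]
    rw [integral_finsetSum _ fun i _ => ((hX.hasGaussianLaw_eval i).integrable).const_mul (a i)]
    refine Finset.sum_eq_zero fun i _ => ?_
    rw [integral_const_mul, h0, mul_zero]
  rw [h2.map_eq_gaussianReal, h3]
  congr 1
  rw [variance_of_integral_eq_zero h2.aemeasurable h3]
  have : ∫ ω, z ω ^ 2 ∂P = ‖z‖ ^ 2 := by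
    rw [← real_inner_self_eq_norm_sq, L2.inner_def]
    exact integral_congr_ae (Eventually.of_forall fun ω => by simp [sq])
  rw [this]
  ext
  simp

/-- Centred Gaussian laws survive `L²` limits: along an almost surely convergent subsequence the
characteristic functions converge by dominated convergence, and the variances converge with the
norms. -/
theorem map_eq_gaussianReal_of_mem_closure_span {X : ι → Ω → ℝ} (hX : IsGaussianProcess X P)
    (h0 : ∀ i, P[X i] = 0) {v : ι → Lp ℝ 2 P} (hv : ∀ i, v i =ᵐ[P] X i)
    {z : Lp ℝ 2 P} (hz : z ∈ (Submodule.span ℝ (range v)).topologicalClosure) :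
    P.map z = gaussianReal 0 (‖z‖₊ ^ 2) := by
  have := hX.isProbabilityMeasure
  rw [← SetLike.mem_coe, Submodule.topologicalClosure_coe] at hz
  obtain ⟨g, hg, hgz⟩ := mem_closure_iff_seq_limit.1 hz
  have hm : TendstoInMeasure P (fun k => (g k : Ω → ℝ)) atTop z :=
    tendstoInMeasure_of_tendsto_Lp hgz
  obtain ⟨ns, hns, hae⟩ := hm.exists_seq_tendsto_ae
  have hzm : AEMeasurable z P := (Lp.aestronglyMeasurable z).aemeasurable
  have hgm : ∀ k, AEMeasurable (g k) P := fun k => (Lp.aestronglyMeasurable (g k)).aemeasurable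
  have : IsProbabilityMeasure (P.map z) := Measure.isProbabilityMeasure_map hzm
  refine Measure.ext_of_charFun (funext fun t => ?_)
  have h1 : Tendsto (fun k => charFun (P.map (g (ns k))) t) atTop (𝓝 (charFun (P.map z) t)) := by
    have he : ∀ w : Lp ℝ 2 P, AEMeasurable w P → charFun (P.map w) t =
        ∫ ω, Complex.exp (t * w ω * Complex.I) ∂P := fun w hw => by
      rw [charFun_apply_real, integral_map hw (by fun_prop)]
    simp only [he _ (hgm _), he _ hzm]
    refine tendsto_integral_of_dominated_convergence (fun _ => 1) (fun k => ?_)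
      (integrable_const _) (fun k => Eventually.of_forall fun ω => ?_) ?_
    · have := hgm (ns k)
      exact AEMeasurable.aestronglyMeasurable (by fun_prop)
    · rw [← Complex.ofReal_mul, Complex.norm_exp_ofReal_mul_I]
    · filter_upwards [hae] with ω hω
      exact ((Continuous.tendsto (f := fun x : ℝ => Complex.exp (t * x * Complex.I))
        (by fun_prop) _)).comp hω
  have h2 : Tendsto (fun k => charFun (P.map (g (ns k))) t) atTop
      (𝓝 (charFun (gaussianReal 0 (‖z‖₊ ^ 2)) t)) := by
    simp only [map_eq_gaussianReal_of_mem_span hX h0 hv (hg _), charFun_gaussianReal]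
    have hn : Tendsto (fun k => ‖g (ns k)‖) atTop (𝓝 ‖z‖) := (hgz.comp hns.tendsto_atTop).norm
    have := (Continuous.tendsto (f := fun x : ℝ =>
      Complex.exp (t * (0 : ℝ) * Complex.I - (x : ℂ) ^ 2 * t ^ 2 / 2)) (by fun_prop) _).comp hn
    simpa using! this
  exact tendsto_nhds_unique h1 h2

theorem mgf_of_map_eq_gaussianReal [IsProbabilityMeasure P] {Z : Ω → ℝ} {v : ℝ≥0}
    (hZ : P.map Z = gaussianReal 0 v) (t : ℝ) :
    ∫ ω, Real.exp (t * Z ω) ∂P = Real.exp (v * t ^ 2 / 2) := by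
  simpa [mgf] using mgf_gaussianReal hZ t

theorem integrable_exp_of_map_eq_gaussianReal [IsProbabilityMeasure P] {Z : Ω → ℝ} {v : ℝ≥0}
    (hZ : P.map Z = gaussianReal 0 v) (t : ℝ) : Integrable (fun ω => Real.exp (t * Z ω)) P := by
  -- A non-integrable function has integral `0`, whereas the moment generating function is a
  -- positive number.
  by_contra h
  have := mgf_of_map_eq_gaussianReal hZ t
  rw [integral_undef h] at this
  exact (Real.exp_pos _).ne this

/-- Positivity of `mgf X P` encodes integrability of every exponential, since the default value of
the integral is `0`. The complex moment generating functions then agree on the whole plane. -/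
theorem map_eq_of_forall_mgf_eq {Ω' : Type*} [MeasurableSpace Ω'] {Q : Measure Ω'}
    [IsProbabilityMeasure P] [IsProbabilityMeasure Q] {X : Ω → ℝ} {Y : Ω' → ℝ}
    (hX : AEMeasurable X P) (hY : AEMeasurable Y Q) (h : mgf X P = mgf Y Q)
    (hpos : ∀ t, 0 < mgf X P t) : P.map X = Q.map Y := by
  refine Measure.ext_of_complexMGF_eq hX hY (funext fun z => ?_)
  refine eqOn_complexMGF_of_mgf h ?_
  have : integrableExpSet X P = univ := eq_univ_of_forall fun t => by
    by_contra hc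
    exact (hpos t).ne' (integral_undef hc)
  simp [this]

open scoped InnerProductSpace in
/-- **Cameron-Martin**: tilting by an element `z` of the Gaussian Hilbert space of a centred
Gaussian process shifts the process by its covariances with `z`. -/
theorem map_add_inner_eq_map_tilted {X : ι → Ω → ℝ} (hX : IsGaussianProcess X P)
    (hXm : AEMeasurable (fun ω i => X i ω) P)
    (h0 : ∀ i, P[X i] = 0) {v : ι → Lp ℝ 2 P} (hv : ∀ i, v i =ᵐ[P] X i)
    {z : Lp ℝ 2 P} (hz : z ∈ (Submodule.span ℝ (range v)).topologicalClosure) :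
    P.map (fun ω i => X i ω + ⟪v i, z⟫_ℝ) = (P.tilted z).map (fun ω i => X i ω) := by
  have := hX.isProbabilityMeasure
  have hzg := map_eq_gaussianReal_of_mem_closure_span hX h0 hv hz
  have hzi : Integrable (fun ω => Real.exp (z ω)) P := by
    simpa using integrable_exp_of_map_eq_gaussianReal hzg 1
  have : IsProbabilityMeasure (P.tilted z) := isProbabilityMeasure_tilted hzi
  have hac : P.tilted z ≪ P := tilted_absolutelyContinuous _ _
  have hXc : AEMeasurable (fun ω i => X i ω + ⟪v i, z⟫_ℝ) P := by
    refine (measurable_pi_lambda (fun (x : ι → ℝ) i => x i + ⟪v i, z⟫_ℝ) ?_).comp_aemeasurable hXm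
    exact fun i => (measurable_pi_apply i).add_const _
  have : IsProbabilityMeasure (P.map (fun ω i => X i ω + ⟪v i, z⟫_ℝ)) :=
    Measure.isProbabilityMeasure_map hXc
  have hXt := hXm.mono_ac hac
  have : IsProbabilityMeasure ((P.tilted z).map (fun ω i => X i ω)) :=
    Measure.isProbabilityMeasure_map hXt
  -- It suffices to compare finite-dimensional marginals, and for these one linear functional at a
  -- time. Each such functional is an element `y` of the Gaussian Hilbert space, and the moment
  -- generating functions of `y + ⟪y, z⟫` under `P` and of `y` under the tilted measure coincide.
  refine IsProjectiveLimit.unique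
    (P := fun J : Finset ι => (P.map (fun ω i => X i ω + ⟪v i, z⟫_ℝ)).map J.restrict)
    (fun J => rfl) (fun J => ?_)
  have hr : Measurable (J.restrict : (ι → ℝ) → (J → ℝ)) := Finset.measurable_restrict J
  have : IsProbabilityMeasure (((P.tilted z).map (fun ω i => X i ω)).map J.restrict) :=
    Measure.isProbabilityMeasure_map hr.aemeasurable
  have : IsProbabilityMeasure ((P.map (fun ω i => X i ω + ⟪v i, z⟫_ℝ)).map J.restrict) :=
    Measure.isProbabilityMeasure_map hr.aemeasurable
  refine Measure.ext_of_charFunDual (funext fun L => ?_)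
  simp only [charFunDual_eq_charFun_map_one]
  congr 1
  have hL : Measurable L := L.continuous.measurable
  rw [Measure.map_map hL hr, Measure.map_map hL hr,
    AEMeasurable.map_map_of_aemeasurable (hL.comp hr).aemeasurable hXc,
    AEMeasurable.map_map_of_aemeasurable (hL.comp hr).aemeasurable hXt]
  obtain ⟨a, ha⟩ : ∃ a : J → ℝ, ∀ x, L x = ∑ i, a i * x i := by
    classical
    refine ⟨fun i => L (Pi.single i 1), fun x => ?_⟩
    conv_lhs => rw [pi_eq_sum_univ' x]
    simp [map_sum, mul_comm]
  let y : Lp ℝ 2 P := ∑ i : J, a i • v i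
  have hyS : y ∈ (Submodule.span ℝ (range v)).topologicalClosure :=
    Submodule.sum_mem _ fun i _ => Submodule.smul_mem _ _
      (Submodule.le_topologicalClosure _ (Submodule.subset_span ⟨i, rfl⟩))
  have hy : y =ᵐ[P] fun ω => ∑ i : J, a i * X i ω :=
    coeFn_sum_smul (v := fun i : J => v i) (fun i => hv i) Finset.univ a
  have hyz : ⟪y, z⟫_ℝ = ∑ i : J, a i * ⟪v i, z⟫_ℝ := by
    simp only [y, sum_inner, real_inner_smul_left]
  have e1 : ((L ∘ J.restrict) ∘ fun ω i => X i ω + ⟪v i, z⟫_ℝ) =ᵐ[P] fun ω => y ω + ⟪y, z⟫_ℝ := by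
    filter_upwards [hy] with ω hω
    rw [hω, hyz, ← Finset.sum_add_distrib]
    simp [ha, mul_add]
  have e2 : ((L ∘ J.restrict) ∘ fun ω i => X i ω) =ᵐ[P.tilted z] y := by
    filter_upwards [hac.ae_le hy] with ω hω
    rw [hω]
    simp [ha]
  rw [Measure.map_congr e1, Measure.map_congr e2]
  have hym : AEMeasurable y P := (Lp.aestronglyMeasurable y).aemeasurable
  have hm1 : ∀ t, mgf (fun ω => y ω + ⟪y, z⟫_ℝ) P t =
      Real.exp (t * ⟪y, z⟫_ℝ + ‖y‖ ^ 2 * t ^ 2 / 2) := fun t => by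
    have := mgf_of_map_eq_gaussianReal
      (map_eq_gaussianReal_of_mem_closure_span hX h0 hv hyS) t
    rw [mgf]
    simp_rw [mul_add, Real.exp_add, integral_mul_const]
    rw [this]
    push_cast
    rw [mul_comm]
  have hm2 : ∀ t, mgf y (P.tilted z) t =
      Real.exp (t * ⟪y, z⟫_ℝ + ‖y‖ ^ 2 * t ^ 2 / 2) := fun t => by
    rw [mgf, integral_exp_tilted]
    have h1 := mgf_of_map_eq_gaussianReal hzg 1
    have h2 := mgf_of_map_eq_gaussianReal (map_eq_gaussianReal_of_mem_closure_span hX h0 hv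
      (Submodule.add_mem _ hz (Submodule.smul_mem _ t hyS))) 1
    simp only [one_mul] at h1 h2
    have h3 : ∫ ω, Real.exp ((z : Ω → ℝ) ω + t * y ω) ∂P =
        ∫ ω, Real.exp ((z + t • y : Lp ℝ 2 P) ω) ∂P := by
      refine integral_congr_ae ?_
      filter_upwards [Lp.coeFn_add z (t • y), Lp.coeFn_smul t y] with ω h4 h5
      rw [h4, Pi.add_apply, h5]
      rfl
    simp only [Pi.add_apply]
    rw [h3, h1, h2, ← Real.exp_sub]
    congr 1
    push_cast
    rw [norm_add_sq_real, norm_smul, real_inner_smul_right,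
      real_inner_comm, mul_pow, Real.norm_eq_abs, sq_abs]
    ring
  exact map_eq_of_forall_mgf_eq (hym.mono_ac hac) (hym.add_const _)
    (funext fun t => (hm2 t).trans (hm1 t).symm) (fun t => by rw [hm2]; exact Real.exp_pos _)

/-- Cauchy-Schwarz against the difference of the two densities `exp(±Z - v/2)`, whose second moment
is `exp(-v)(2 exp(2v) - 2) = 4 sinh v`. -/
theorem sq_integral_tilted_sub_le [IsProbabilityMeasure P] {Z : Ω → ℝ} {v : ℝ≥0}
    (hZm : AEMeasurable Z P) (hZ : P.map Z = gaussianReal 0 v) {T : Ω → ℝ} (hT : MemLp T 2 P) :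
    ((∫ ω, T ω ∂(P.tilted Z)) - ∫ ω, T ω ∂(P.tilted (-Z))) ^ 2 ≤
      Var[T; P] * (4 * Real.sinh v) := by
  let D : Ω → ℝ := fun ω => Real.exp (Z ω) - Real.exp (-Z ω)
  have hexp : ∀ t : ℝ, MemLp (fun ω => Real.exp (t * Z ω)) 2 P := fun t => by
    rw [memLp_two_iff_integrable_sq (by fun_prop : AEMeasurable _ P).aestronglyMeasurable]
    refine (integrable_exp_of_map_eq_gaussianReal hZ (2 * t)).congr
      (Eventually.of_forall fun ω => ?_)
    simp only
    rw [← Real.exp_nat_mul]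
    push_cast
    ring_nf
  have he1 : MemLp (fun ω => Real.exp (Z ω)) 2 P := by simpa using hexp 1
  have he2 : MemLp (fun ω => Real.exp (-Z ω)) 2 P := by simpa using hexp (-1)
  have hD : MemLp D 2 P := he1.sub he2
  have i1 : ∫ ω, Real.exp (Z ω) ∂P = Real.exp (v / 2) := by
    simpa using mgf_of_map_eq_gaussianReal hZ 1
  have i2 : ∫ ω, Real.exp (-Z ω) ∂P = Real.exp (v / 2) := by
    simpa using mgf_of_map_eq_gaussianReal hZ (-1)
  have i3 : ∫ ω, D ω ^ 2 ∂P = 2 * Real.exp (2 * v) - 2 := by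
    have hs : ∀ ω, D ω ^ 2 = Real.exp (2 * Z ω) + Real.exp (-2 * Z ω) - 2 := fun ω => by
      have h1 : Real.exp (2 * Z ω) = Real.exp (Z ω) ^ 2 := by
        rw [← Real.exp_nat_mul]; norm_num
      have h2 : Real.exp (-2 * Z ω) = Real.exp (-Z ω) ^ 2 := by
        rw [← Real.exp_nat_mul]; push_cast; ring_nf
      have h3 : Real.exp (Z ω) * Real.exp (-Z ω) = 1 := by
        rw [← Real.exp_add]; simp
      simp only [D]
      rw [h1, h2]
      linear_combination (-2) * h3
    simp_rw [hs]
    rw [integral_sub, integral_add, mgf_of_map_eq_gaussianReal hZ,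
      mgf_of_map_eq_gaussianReal hZ]
    · simp
      ring_nf
    · exact integrable_exp_of_map_eq_gaussianReal hZ _
    · exact integrable_exp_of_map_eq_gaussianReal hZ _
    · exact (integrable_exp_of_map_eq_gaussianReal hZ _).add
        (integrable_exp_of_map_eq_gaussianReal hZ _)
    · exact integrable_const _
  -- Both tilts have the normalisation `exp(v/2)`, so `D` has mean zero and `T` may be centred; this
  -- is how the variance, rather than the second moment, appears.
  have hdiff : (∫ ω, T ω ∂(P.tilted Z)) - ∫ ω, T ω ∂(P.tilted (-Z)) =
      Real.exp (-(v / 2)) * ∫ ω, (T ω - P[T]) * D ω ∂P := by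
    rw [integral_tilted, integral_tilted]
    simp only [Pi.neg_apply, i1, i2, smul_eq_mul]
    have hT1 : Integrable (fun ω => T ω * Real.exp (Z ω)) P := hT.integrable_mul he1
    have hT2 : Integrable (fun ω => T ω * Real.exp (-Z ω)) P := hT.integrable_mul he2
    have hT3 : Integrable (fun ω => T ω * Real.exp (Z ω) - T ω * Real.exp (-Z ω)) P := hT1.sub hT2
    have hD1 : Integrable (fun ω => P[T] * (Real.exp (Z ω) - Real.exp (-Z ω))) P :=
      ((he1.integrable one_le_two).sub (he2.integrable one_le_two)).const_mul _
    have e : ∀ ω, (T ω - P[T]) * D ω = (T ω * Real.exp (Z ω) - T ω * Real.exp (-Z ω)) -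
        P[T] * (Real.exp (Z ω) - Real.exp (-Z ω)) := fun ω => by simp only [D]; ring
    simp_rw [e]
    rw [integral_sub hT3 hD1,
      integral_sub hT1 hT2, integral_const_mul,
      integral_sub (he1.integrable one_le_two) (he2.integrable one_le_two), i1, i2, Real.exp_neg]
    have e1 : ∀ ω, Real.exp (Z ω) / Real.exp (v / 2) * T ω =
      (Real.exp (v / 2))⁻¹ * (T ω * Real.exp (Z ω)) := fun ω => by ring
    have e2 : ∀ ω, Real.exp (-Z ω) / Real.exp (v / 2) * T ω =
      (Real.exp (v / 2))⁻¹ * (T ω * Real.exp (-Z ω)) := fun ω => by ring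
    simp_rw [e1, e2, integral_const_mul]
    ring
  have hCS : (∫ ω, (T ω - P[T]) * D ω ∂P) ^ 2 ≤ Var[T; P] * ∫ ω, D ω ^ 2 ∂P := by
    rw [variance_eq_integral hT.aestronglyMeasurable.aemeasurable]
    have hTc : MemLp (fun ω => T ω - P[T]) 2 P := hT.sub (memLp_const _)
    have key := integral_mul_le_Lp_mul_Lq_of_nonneg (μ := P) (p := 2) (q := 2)
      Real.HolderConjugate.two_two (f := fun ω => |T ω - P[T]|) (g := fun ω => |D ω|)
      (Eventually.of_forall fun _ => abs_nonneg _) (Eventually.of_forall fun _ => abs_nonneg _)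
      (by simpa using! hTc.abs) (by simpa using! hD.abs)
    simp only [Real.rpow_two, sq_abs] at key
    have hle : |∫ ω, (T ω - P[T]) * D ω ∂P| ≤ ∫ ω, |T ω - P[T]| * |D ω| ∂P := by
      simpa only [abs_mul] using abs_integral_le_integral_abs (f := fun ω => (T ω - P[T]) * D ω)
    rw [← Real.sqrt_eq_rpow, ← Real.sqrt_eq_rpow] at key
    calc (∫ ω, (T ω - P[T]) * D ω ∂P) ^ 2 = |∫ ω, (T ω - P[T]) * D ω ∂P| ^ 2 := (sq_abs _).symm
      _ ≤ (√(∫ ω, (T ω - P[T]) ^ 2 ∂P) * √(∫ ω, D ω ^ 2 ∂P)) ^ 2 := by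
        gcongr
        exact hle.trans key
      _ = _ := by
        rw [mul_pow, Real.sq_sqrt (integral_nonneg fun _ => sq_nonneg _),
          Real.sq_sqrt (integral_nonneg fun _ => sq_nonneg _)]
  rw [hdiff, mul_pow]
  calc Real.exp (-(v / 2)) ^ 2 * (∫ ω, (T ω - P[T]) * D ω ∂P) ^ 2
      ≤ Real.exp (-(v / 2)) ^ 2 * (Var[T; P] * (2 * Real.exp (2 * v) - 2)) := by
        rw [← i3]; gcongr
    _ = Var[T; P] * (4 * Real.sinh v) := by
      have h1 : Real.exp (-(v / 2)) ^ 2 = Real.exp (-v) := by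
        rw [← Real.exp_nat_mul]; push_cast; ring_nf
      have h2 : Real.exp (2 * v) = Real.exp v ^ 2 := by
        rw [← Real.exp_nat_mul]; norm_num
      have h3 : Real.exp v * Real.exp (-v) = 1 := by rw [← Real.exp_add]; simp
      rw [h1, h2, Real.sinh_eq]
      linear_combination (2 * Var[T; P] * Real.exp v) * h3

end Gaussian

/-! ### Change of drift in the white noise model -/

section Drift

variable {Ω : Type*} [MeasurableSpace Ω] {P : Measure Ω} {W : ℝ≥0 → Ω → ℝ}

open scoped InnerProductSpace in
/-- Shifting a Brownian motion on `[0,1]` by the primitive of a continuous function is a tilting by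
a centred Gaussian variable with variance at most the squared `L²` norm of the function. -/
theorem exists_gaussian_tilted_eq (hW : IsBrownianReal W P) {k : ℝ → ℝ} (hk : Continuous k) :
    ∃ (Z : Ω → ℝ) (v : ℝ≥0), AEMeasurable Z P ∧ P.map Z = gaussianReal 0 v ∧
      (v : ℝ) ≤ ∫ u in (0 : ℝ)..1, k u ^ 2 ∧
      P.map (fun ω (x : I) => W (unitInterval.toNNReal x) ω + ∫ u in (0 : ℝ)..x, k u) =
        (P.tilted Z).map (fun ω (x : I) => W (unitInterval.toNNReal x) ω) ∧
      P.map (fun ω (x : I) => W (unitInterval.toNNReal x) ω - ∫ u in (0 : ℝ)..x, k u) =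
        (P.tilted (-Z)).map (fun ω (x : I) => W (unitInterval.toNNReal x) ω) := by
  have hP := hW.isGaussianProcess.isProbabilityMeasure
  let X : I → Ω → ℝ := fun x => W (unitInterval.toNNReal x)
  have hX : IsGaussianProcess X P := hW.isGaussianProcess.comp_right unitInterval.toNNReal
  have hX0 : ∀ x, P[X x] = 0 := fun x => hW.integral_eval _
  have hXm : AEMeasurable (fun ω x => X x ω) P := by
    refine (aemeasurable_observation hW 1 0).congr (Eventually.of_forall fun ω => ?_)
    funext x
    simp [observation, X]
  have hX2 : ∀ x, MemLp (X x) 2 P := fun x => (hX.hasGaussianLaw_eval x).memLp_two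
  let v : I → Lp ℝ 2 P := fun x => (hX2 x).toLp
  have hv : ∀ x, v x =ᵐ[P] X x := fun x => (hX2 x).coeFn_toLp
  have hfin : ∀ x : I, volume (Ioc (0 : ℝ) x) ≠ ∞ := fun x => by simp
  let u : I → Lp ℝ 2 (volume : Measure ℝ) := fun x =>
    indicatorConstLp 2 measurableSet_Ioc (hfin x) (1 : ℝ)
  -- Both sides equal `min x y`: an overlap length on the left, the Brownian covariance on the
  -- right.
  have huv : ∀ x y, ⟪u x, u y⟫_ℝ = ⟪v x, v y⟫_ℝ := fun x y => by
    rw [L2.real_inner_indicatorConstLp_one_indicatorConstLp_one measurableSet_Ioc measurableSet_Ioc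
      (hfin x) (hfin y), L2.inner_def]
    have h1 : ∫ ω, ⟪(v x : Ω → ℝ) ω, (v y : Ω → ℝ) ω⟫_ℝ ∂P = ∫ ω, (X x * X y) ω ∂P := by
      refine integral_congr_ae ?_
      filter_upwards [hv x, hv y] with ω h1 h2
      simp [h1, h2, mul_comm]
    have h2 := covariance_eq_sub (hX2 x) (hX2 y)
    rw [hX0, hX0, mul_zero, sub_zero] at h2
    rw [h1, ← h2, hW.covariance_eval, Ioc_inter_Ioc]
    rcases le_total x y with hxy | hxy
    · have h : (x : ℝ) ≤ y := hxy
      have h' : unitInterval.toNNReal x ≤ unitInterval.toNNReal y := hxy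
      simp [Measure.real, h, h', x.2.1]
    · have h : (y : ℝ) ≤ x := hxy
      have h' : unitInterval.toNNReal y ≤ unitInterval.toNNReal x := hxy
      simp [Measure.real, h, h', y.2.1]
  have hkL : MemLp ((Ioc (0 : ℝ) 1).indicator k) 2 volume := by
    rw [memLp_indicator_iff_restrict measurableSet_Ioc]
    rw [memLp_two_iff_integrable_sq hk.aestronglyMeasurable]
    exact (hk.pow 2).integrableOn_Ioc
  let f : Lp ℝ 2 (volume : Measure ℝ) := hkL.toLp
  have hf : f =ᵐ[volume] (Ioc (0 : ℝ) 1).indicator k := hkL.coeFn_toLp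
  have huf : ∀ x : I, ⟪u x, f⟫_ℝ = ∫ s in (0 : ℝ)..x, k s := fun x => by
    rw [L2.inner_indicatorConstLp_one, intervalIntegral.integral_of_le x.2.1]
    refine (setIntegral_congr_ae measurableSet_Ioc ?_)
    filter_upwards [hf] with s hs hsx
    rw [hs, indicator_of_mem (Ioc_subset_Ioc_right x.2.2 hsx)]
  have hfn : ‖f‖ ^ 2 = ∫ s in (0 : ℝ)..1, k s ^ 2 := by
    rw [← real_inner_self_eq_norm_sq, L2.inner_def, intervalIntegral.integral_of_le zero_le_one,
      ← integral_indicator measurableSet_Ioc]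
    refine integral_congr_ae ?_
    filter_upwards [hf] with s hs
    rw [hs]
    by_cases h : s ∈ Ioc (0 : ℝ) 1 <;> simp [h, sq]
  -- `z` plays the role of the Wiener integral of `k`; its negative handles the opposite shift.
  obtain ⟨z, hz, hvz, hzf⟩ := exists_mem_closure_span_inner_eq huv f
  have hnz : -z ∈ (Submodule.span ℝ (range v)).topologicalClosure := Submodule.neg_mem _ hz
  refine ⟨z, ‖z‖₊ ^ 2, (Lp.aestronglyMeasurable z).aemeasurable,
    map_eq_gaussianReal_of_mem_closure_span hX hX0 hv hz, ?_, ?_, ?_⟩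
  · rw [← hfn]
    push_cast
    gcongr
  · rw [← map_add_inner_eq_map_tilted hX hXm hX0 hv hz]
    simp only [hvz, huf, X]
  · rw [← tilted_congr (Lp.coeFn_neg z), ← map_add_inner_eq_map_tilted hX hXm hX0 hv hnz]
    simp only [inner_neg_right, hvz, huf, X, sub_eq_add_neg]

/-- The observation as a function of the driving path. -/
theorem observation_add_eq {Ω : Type*} {W : ℝ≥0 → Ω → ℝ} {n : ℝ} (hn : 0 < n) {f k : ℝ → ℝ}
    (hf : IntervalIntegrable f volume 0 1) (hk : Continuous k) (ω : Ω) :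
    observation W n (f + k) ω = (fun (y : I → ℝ) (x : I) =>
      (∫ u in (0 : ℝ)..x, f u) + n ^ (-(1 / 2) : ℝ) * y x)
        (fun x => W (unitInterval.toNNReal x) ω + ∫ u in (0 : ℝ)..x, n ^ (1 / 2 : ℝ) * k u) := by
  funext x
  have hfx : IntervalIntegrable f volume 0 x :=
    hf.mono_set (by rw [uIcc_of_le x.2.1, uIcc_of_le zero_le_one]; exact Icc_subset_Icc_right x.2.2)
  simp only [observation, Pi.add_apply]
  rw [intervalIntegral.integral_add hfx (hk.intervalIntegrable _ _),
    intervalIntegral.integral_const_mul, mul_add, ← mul_assoc (n ^ (-(1 / 2) : ℝ)),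
    ← Real.rpow_add hn]
  norm_num
  ring

/-- The two-point inequality behind all the bounds. The Gaussian tilting estimate is pulled back
along the map from the driving path to the observation; if `T` is not square integrable under `P_f`,
the right side is infinite because `sinh a > 0`. -/
theorem enorm_sq_integral_law_sub_le (hW : IsBrownianReal W P) {n : ℝ} (hn : 0 < n)
    {f k : ℝ → ℝ} (hf : IntervalIntegrable f volume 0 1) (hk : Continuous k)
    {T : (I → ℝ) → ℝ} (hT : Measurable T) {a : ℝ} (ha : 0 < a)
    (hka : n * ∫ u in (0 : ℝ)..1, k u ^ 2 ≤ a) :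
    ‖(∫ y, T y ∂(law P W n (f + k))) - ∫ y, T y ∂(law P W n (f - k))‖ₑ ^ 2 ≤
      var P W n T f * ENNReal.ofReal (4 * Real.sinh a) := by
  have hP := hW.isGaussianProcess.isProbabilityMeasure
  have hprob := isProbabilityMeasure_law hW n f
  have hsinh : 0 < 4 * Real.sinh a := by have := Real.sinh_pos_iff.2 ha; positivity
  by_cases hT2 : MemLp T 2 (law P W n f)
  swap
  · rw [var, evariance_eq_top hT.aestronglyMeasurable hT2, ENNReal.top_mul (by simpa using hsinh)]
    exact le_top
  let φ : (I → ℝ) → I → ℝ := fun y x => (∫ u in (0 : ℝ)..x, f u) + n ^ (-(1 / 2) : ℝ) * y x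
  have hφ : Measurable φ := measurable_pi_lambda _ fun x =>
    ((measurable_pi_apply x).const_mul _).const_add _
  let B : Ω → I → ℝ := fun ω x => W (unitInterval.toNNReal x) ω
  have hB : AEMeasurable B P := by
    refine (aemeasurable_observation hW 1 0).congr (Eventually.of_forall fun ω => ?_)
    funext x
    simp [observation, B]
  have hshift : ∀ c : I → ℝ, AEMeasurable (fun ω x => B ω x + c x) P := fun c =>
    (measurable_pi_lambda (fun (y : I → ℝ) x => y x + c x)
      fun x => (measurable_pi_apply x).add_const _).comp_aemeasurable hB
  obtain ⟨Z, v, hZm, hZ, hv, hp, hm⟩ :=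
    exists_gaussian_tilted_eq hW (hk.const_mul (n ^ (1 / 2 : ℝ)))
  -- A drift `k` in the observation is a drift `n^(1/2) k` of the Brownian path, which gives the
  -- factor `n`.
  have hva : (v : ℝ) ≤ a := by
    refine (hv.trans_eq ?_).trans hka
    simp_rw [mul_pow, intervalIntegral.integral_const_mul]
    rw [← Real.rpow_natCast, ← Real.rpow_mul hn.le]
    norm_num
  have e0 : law P W n f = P.map (φ ∘ B) := rfl
  have e1 : law P W n (f + k) = (P.tilted Z).map (φ ∘ B) := by
    rw [← AEMeasurable.map_map_of_aemeasurable hφ.aemeasurable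
      (hB.mono_ac (tilted_absolutelyContinuous _ _)), ← hp,
      AEMeasurable.map_map_of_aemeasurable hφ.aemeasurable (hshift _), law]
    exact congrArg P.map (funext fun ω => observation_add_eq hn hf hk ω)
  have e2 : law P W n (f - k) = (P.tilted (-Z)).map (φ ∘ B) := by
    rw [← AEMeasurable.map_map_of_aemeasurable hφ.aemeasurable
      (hB.mono_ac (tilted_absolutelyContinuous _ _)), ← hm]
    simp_rw [sub_eq_add_neg]
    rw [AEMeasurable.map_map_of_aemeasurable hφ.aemeasurable (hshift _), law]
    refine congrArg P.map (funext fun ω => (observation_add_eq hn hf hk.neg ω).trans ?_)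
    simp only [Pi.neg_apply, mul_neg, intervalIntegral.integral_neg]
    rfl
  have hφB : AEMeasurable (φ ∘ B) P := hφ.comp_aemeasurable hB
  have hTS : MemLp (T ∘ φ ∘ B) 2 P := by
    rw [e0] at hT2
    exact (memLp_map_measure_iff hT.aestronglyMeasurable hφB).1 hT2
  have key := sq_integral_tilted_sub_le hZm hZ hTS
  have hvar : var P W n T f = ENNReal.ofReal Var[T ∘ φ ∘ B; P] := by
    rw [var, ← ofReal_variance hT2, e0, variance_map hT.aemeasurable hφB]
  rw [e1, e2, integral_map (hφB.mono_ac (tilted_absolutelyContinuous _ _)) hT.aestronglyMeasurable,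
    integral_map (hφB.mono_ac (tilted_absolutelyContinuous _ _)) hT.aestronglyMeasurable, hvar,
    ← ENNReal.ofReal_mul (variance_nonneg _ _), ← ofReal_norm,
    ← ENNReal.ofReal_pow (norm_nonneg _), Real.norm_eq_abs, sq_abs]
  refine ENNReal.ofReal_le_ofReal (key.trans ?_)
  gcongr
  · exact variance_nonneg _ _
  · exact Real.sinh_le_sinh.2 hva

end Drift

/-! ### Hölder norms of perturbations -/

section Holder

variable {β : ℝ}

theorem strictFloor_lt (hβ : 0 < β) : (strictFloor β : ℝ) < β := by
  have h1 : 1 ≤ ⌈β⌉₊ := Nat.one_le_ceil_iff.2 hβ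
  have h2 := Nat.ceil_lt_add_one hβ.le
  rw [strictFloor, Nat.cast_sub h1]
  push_cast
  linarith

theorem sub_strictFloor_le_one (hβ : 0 < β) : β - strictFloor β ≤ 1 := by
  have h1 : 1 ≤ ⌈β⌉₊ := Nat.one_le_ceil_iff.2 hβ
  have h2 := Nat.le_ceil β
  rw [strictFloor, Nat.cast_sub h1]
  push_cast
  linarith

theorem contDiffOn_of_holderNorm_lt_top {D : Set ℝ} {f : ℝ → ℝ} (h : holderNorm D β f < ∞) :
    ContDiffOn ℝ (strictFloor β : ℕ) f D := by
  by_contra hc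
  simp [holderNorm, hc] at h

theorem holderNorm_add_le {D : Set ℝ} (hD : UniqueDiffOn ℝ D) (f g : ℝ → ℝ) :
    holderNorm D β (f + g) ≤ holderNorm D β f + holderNorm D β g := by
  by_cases hf : ContDiffOn ℝ (strictFloor β : ℕ) f D
  swap; · simp [holderNorm, hf]
  by_cases hg : ContDiffOn ℝ (strictFloor β : ℕ) g D
  swap; · simp [holderNorm, hg]
  have hadd : ∀ l ≤ strictFloor β, ∀ x ∈ D, iteratedDerivWithin l (f + g) D x =
      iteratedDerivWithin l f D x + iteratedDerivWithin l g D x := fun l hl x hx =>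
    iteratedDerivWithin_add hx hD ((hf x hx).of_le (by exact_mod_cast hl))
      ((hg x hx).of_le (by exact_mod_cast hl))
  have hfg : ContDiffOn ℝ (strictFloor β : ℕ) (f + g) D := hf.add hg
  simp only [holderNorm, if_pos hf, if_pos hg, if_pos hfg]
  rw [add_add_add_comm, ← Finset.sum_add_distrib]
  refine add_le_add (Finset.sum_le_sum fun l hl => ?_) ?_
  · refine iSup₂_le fun x hx => ?_
    rw [hadd l (Nat.lt_succ_iff.1 (Finset.mem_range.1 hl)) x hx]
    refine (enorm_add_le _ _).trans (add_le_add ?_ ?_)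
    · exact le_iSup₂ (f := fun x _ => ‖iteratedDerivWithin l f D x‖ₑ) x hx
    · exact le_iSup₂ (f := fun x _ => ‖iteratedDerivWithin l g D x‖ₑ) x hx
  · refine iSup₂_le fun x hx => iSup₂_le fun y hy => iSup_le fun hxy => ?_
    rw [hadd _ le_rfl x hx, hadd _ le_rfl y hy, add_sub_add_comm]
    refine (ENNReal.div_le_div_right (enorm_add_le _ _) _).trans ?_
    rw [ENNReal.add_div]
    gcongr
    · exact le_iSup₂_of_le x hx (le_iSup₂_of_le y hy (le_iSup_of_le hxy le_rfl))
    · exact le_iSup₂_of_le x hx (le_iSup₂_of_le y hy (le_iSup_of_le hxy le_rfl))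

/-- The rescaled kernel `x ↦ V h^β K((x - x₀) / h)`. -/
def bump (K : ℝ → ℝ) (β x₀ h V : ℝ) (x : ℝ) : ℝ := V * h ^ β * K (h⁻¹ * (x - x₀))

theorem bump_center {K : ℝ → ℝ} (hK : K 0 = 1) (β x₀ h V : ℝ) :
    bump K β x₀ h V x₀ = V * h ^ β := by simp [bump, hK]

theorem continuous_bump {K : ℝ → ℝ} (hK : Continuous K) (β x₀ h V : ℝ) :
    Continuous (bump K β x₀ h V) := by unfold bump; fun_prop

theorem iteratedDeriv_bump {K : ℝ → ℝ} {l : ℕ} (hK : ContDiff ℝ l K) (β x₀ h V x : ℝ) :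
    iteratedDeriv l (bump K β x₀ h V) x =
      V * h ^ β * ((h⁻¹) ^ l * iteratedDeriv l K (h⁻¹ * (x - x₀))) := by
  unfold bump
  rw [iteratedDeriv_const_mul_field,
    iteratedDeriv_comp_sub_const (f := fun z => K (h⁻¹ * z)),
    iteratedDeriv_comp_const_smul hK]
  rfl

theorem contDiff_of_mem_kernels {K : ℝ → ℝ} (hK : K ∈ kernels β) :
    ContDiff ℝ (strictFloor β : ℕ) K :=
  contDiffOn_univ.1 (contDiffOn_of_holderNorm_lt_top hK.1)

theorem continuous_of_mem_kernels {K : ℝ → ℝ} (hK : K ∈ kernels β) : Continuous K :=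
  (contDiff_of_mem_kernels hK).continuous

/-- The `l`-th derivative scales by `V h^(β - l)`, and `h^(β - l) ≤ 1` since `l < β` and `h ≤ 1`.
The Hölder quotient of the top derivative is scale invariant: the factor `h^(β - m)` cancels. -/
theorem holderNorm_bump_le (hβ : 0 < β) {K : ℝ → ℝ} (hK : K ∈ kernels β) (x₀ V : ℝ) {h : ℝ}
    (hh : 0 < h) (hh1 : h ≤ 1) :
    holderNorm (Icc 0 1) β (bump K β x₀ h V) ≤ ENNReal.ofReal |V| * holderNorm univ β K := by
  have hKc := contDiff_of_mem_kernels hK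
  have hbc : ContDiff ℝ (strictFloor β : ℕ) (bump K β x₀ h V) := by
    unfold bump
    exact contDiff_const.mul (hKc.comp (contDiff_const.mul (contDiff_id.sub contDiff_const)))
  have hder : ∀ l ≤ strictFloor β, ∀ x ∈ Icc (0 : ℝ) 1,
      iteratedDerivWithin l (bump K β x₀ h V) (Icc 0 1) x =
        V * h ^ (β - l) * iteratedDeriv l K (h⁻¹ * (x - x₀)) := fun l hl x hx => by
    have hl' : (l : WithTop ℕ∞) ≤ (strictFloor β : ℕ) := by exact_mod_cast hl
    rw [iteratedDerivWithin_eq_iteratedDeriv (uniqueDiffOn_Icc zero_lt_one)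
      (hbc.of_le hl').contDiffAt hx, iteratedDeriv_bump (hKc.of_le hl'), Real.rpow_sub hh,
      Real.rpow_natCast, inv_pow]
    field_simp
  simp only [holderNorm, if_pos hbc.contDiffOn, if_pos hKc.contDiffOn, iteratedDerivWithin_univ]
  rw [mul_add, Finset.mul_sum]
  refine add_le_add (Finset.sum_le_sum fun l hl => ?_) ?_
  · have hlm : l ≤ strictFloor β := Nat.lt_succ_iff.1 (Finset.mem_range.1 hl)
    refine iSup₂_le fun x hx => ?_
    rw [hder l hlm x hx, enorm_mul]
    gcongr
    · rw [← ofReal_norm, Real.norm_eq_abs, abs_mul,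
        abs_of_pos (Real.rpow_pos_of_pos hh _)]
      refine ENNReal.ofReal_le_ofReal (mul_le_of_le_one_right (abs_nonneg _) ?_)
      refine Real.rpow_le_one hh.le hh1 ?_
      have h1 : (l : ℝ) ≤ strictFloor β := by exact_mod_cast hlm
      linarith [strictFloor_lt hβ]
    · exact le_iSup₂_of_le (h⁻¹ * (x - x₀)) (mem_univ _) le_rfl
  · set m := strictFloor β
    refine iSup₂_le fun x hx => iSup₂_le fun y hy => iSup_le fun hxy => ?_
    rw [hder m le_rfl x hx, hder m le_rfl y hy, ← mul_sub, enorm_mul]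
    have hne : h⁻¹ * (x - x₀) ≠ h⁻¹ * (y - x₀) := by
      intro hc
      exact hxy (by simpa using mul_left_cancel₀ (inv_ne_zero hh.ne') hc)
    refine le_trans (le_of_eq ?_) (mul_le_mul_right (le_iSup₂_of_le (h⁻¹ * (x - x₀)) (mem_univ _)
      (le_iSup₂_of_le (h⁻¹ * (y - x₀)) (mem_univ _) (le_iSup_of_le hne le_rfl))) _)
    have habs : |h⁻¹ * (x - x₀) - h⁻¹ * (y - x₀)| = |x - y| / h := by
      rw [← mul_sub, sub_sub_sub_cancel_right, abs_mul, abs_of_pos (inv_pos.2 hh)]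
      field_simp
    have hpos : 0 < |x - y| := abs_pos.2 (sub_ne_zero.2 hxy)
    have hhp : 0 < h ^ (β - m) := Real.rpow_pos_of_pos hh _
    rw [habs, Real.div_rpow hpos.le hh.le, ENNReal.ofReal_div_of_pos hhp,
      ← ofReal_norm (V * _), Real.norm_eq_abs, abs_mul, abs_of_pos hhp,
      ENNReal.ofReal_mul (abs_nonneg _), mul_assoc, mul_div_assoc]
    congr 1
    have e1 : ENNReal.ofReal (h ^ (β - m)) ≠ 0 := by simpa using hhp
    rw [div_eq_mul_inv, div_eq_mul_inv, div_eq_mul_inv,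
      ENNReal.mul_inv (Or.inr (by simpa using e1)) (Or.inr (by simp)), inv_inv]
    ring

theorem integral_bump_sq_le {K : ℝ → ℝ} (hKc : Continuous K) (hK2 : eLpNorm K 2 volume ≠ ∞)
    (β x₀ V : ℝ) {h : ℝ} (hh : 0 < h) :
    ∫ u in (0 : ℝ)..1, bump K β x₀ h V u ^ 2 ≤
      V ^ 2 * h ^ (2 * β + 1) * (eLpNorm K 2 volume).toReal ^ 2 := by
  have hKm : MemLp K 2 volume := ⟨hKc.aestronglyMeasurable, hK2.lt_top⟩
  have hKi : Integrable (fun x => K x ^ 2) := hKm.integrable_sq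
  have hL : (eLpNorm K 2 volume).toReal ^ 2 = ∫ x, K x ^ 2 := by
    rw [hKm.eLpNorm_eq_integral_rpow_norm two_ne_zero ENNReal.ofNat_ne_top]
    have h0 : 0 ≤ ∫ x, ‖K x‖ ^ (2 : ℝ≥0∞).toReal := integral_nonneg fun x => by positivity
    rw [ENNReal.toReal_ofReal (by positivity), ← Real.rpow_natCast, ← Real.rpow_mul h0]
    simp
  have hsh : Integrable (fun x => K (h⁻¹ * (x - x₀)) ^ 2) :=
    (hKi.comp_mul_left' (inv_ne_zero hh.ne')).comp_sub_right x₀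
  have hint : ∫ x, K (h⁻¹ * (x - x₀)) ^ 2 = h * ∫ x, K x ^ 2 := by
    rw [integral_sub_right_eq_self (fun x => K (h⁻¹ * x) ^ 2) x₀,
      Measure.integral_comp_mul_left (fun x => K x ^ 2)]
    simp [abs_of_pos hh]
  have hle : ∫ u in (0 : ℝ)..1, K (h⁻¹ * (u - x₀)) ^ 2 ≤ h * ∫ x, K x ^ 2 := by
    rw [← hint, intervalIntegral.integral_of_le zero_le_one]
    exact setIntegral_le_integral hsh (Eventually.of_forall fun x => sq_nonneg _)
  have hpow : h ^ (2 * β + 1) = (h ^ β) ^ 2 * h := by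
    rw [Real.rpow_add hh, Real.rpow_one, mul_comm 2 β, Real.rpow_mul hh.le, Real.rpow_two]
  simp only [bump, mul_pow, intervalIntegral.integral_const_mul]
  rw [hL, hpow]
  calc V ^ 2 * (h ^ β) ^ 2 * ∫ u in (0 : ℝ)..1, K (h⁻¹ * (u - x₀)) ^ 2
      ≤ V ^ 2 * (h ^ β) ^ 2 * (h * ∫ x, K x ^ 2) := by gcongr
    _ = _ := by ring

theorem one_le_holderNorm {K : ℝ → ℝ} (hK : K ∈ kernels β) : 1 ≤ holderNorm univ β K := by
  have hKc := contDiff_of_mem_kernels hK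
  simp only [holderNorm, if_pos hKc.contDiffOn]
  refine le_add_right ?_
  refine le_trans ?_ (Finset.single_le_sum (f := fun l =>
    ⨆ x ∈ univ, ‖iteratedDerivWithin l K univ x‖ₑ) (fun _ _ => zero_le)
    (Finset.mem_range.2 (Nat.succ_pos _)))
  exact le_iSup₂_of_le 0 (mem_univ _) (by simp [hK.2])

theorem eLpNorm_ne_zero_of_mem_kernels {K : ℝ → ℝ} (hK : K ∈ kernels β) :
    eLpNorm K 2 volume ≠ 0 := by
  have hc := continuous_of_mem_kernels hK
  intro h
  rw [eLpNorm_eq_zero_iff hc.aestronglyMeasurable two_ne_zero] at h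
  have := (hc.ae_eq_iff_eq volume continuous_zero).1 h
  simpa [hK.2] using congrFun this 0

theorem exists_mem_kernels_eLpNorm_ne_top (hβ : 0 < β) :
    ∃ K ∈ kernels β, eLpNorm K 2 volume ≠ ∞ := by
  let b : ContDiffBump (0 : ℝ) := ⟨1, 2, one_pos, one_lt_two⟩
  have hb : ∀ n : ℕ, ContDiff ℝ n b := fun n => b.contDiff
  have hbound : ∀ l : ℕ, ∃ B : ℝ, ∀ x, ‖iteratedDeriv l b x‖ ≤ B := fun l => by
    have hc : HasCompactSupport (iteratedDeriv l b) := by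
      induction l with
      | zero => simpa using b.hasCompactSupport
      | succ l ih => rw [iteratedDeriv_succ]; exact ih.deriv
    exact hc.exists_bound_of_continuous ((hb l).continuous_iteratedDeriv l le_rfl)
  choose B hB using hbound
  refine ⟨b, ⟨?_, b.one_of_mem_closedBall (by simp [b])⟩, ?_⟩
  · simp only [holderNorm, if_pos (hb _).contDiffOn, iteratedDerivWithin_univ]
    refine ENNReal.add_lt_top.2 ⟨ENNReal.sum_lt_top.2 fun l _ => ?_, ?_⟩
    · refine lt_of_le_of_lt (iSup₂_le fun x _ => ?_) (ENNReal.ofReal_lt_top (r := B l))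
      rw [← ofReal_norm]
      exact ENNReal.ofReal_le_ofReal (hB l x)
    · set m := strictFloor β
      have hB0 : ∀ l, 0 ≤ B l := fun l => (norm_nonneg _).trans (hB l 0)
      refine lt_of_le_of_lt (iSup₂_le fun x _ => iSup₂_le fun y _ => iSup_le fun hxy => ?_)
        (ENNReal.ofReal_lt_top (r := B (m + 1) + 2 * B m))
      have hpos : 0 < |x - y| := abs_pos.2 (sub_ne_zero.2 hxy)
      have hap : 0 < |x - y| ^ (β - m) := Real.rpow_pos_of_pos hpos _
      rw [← ofReal_norm, ← ENNReal.ofReal_div_of_pos hap]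
      refine ENNReal.ofReal_le_ofReal ((div_le_iff₀ hap).2 ?_)
      have hα : 0 < β - m := sub_pos.2 (strictFloor_lt hβ)
      have hα1 : β - m ≤ 1 := sub_strictFloor_le_one hβ
      -- At distance at most `1` the mean value inequality suffices, as `β - m ≤ 1`; beyond that the
      -- sup bound does, as the denominator is at least `1`.
      rcases le_total |x - y| 1 with h1 | h1
      · have hdiff : Differentiable ℝ (iteratedDeriv m b) :=
          (hb (m + 1)).differentiable_iteratedDeriv m (by exact_mod_cast Nat.lt_succ_self m)
        have hlip := convex_univ.norm_image_sub_le_of_norm_deriv_le (f := iteratedDeriv m b)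
          (C := B (m + 1)) (fun z _ => hdiff z)
          (fun z _ => by rw [← iteratedDeriv_succ]; exact hB (m + 1) z) (mem_univ y) (mem_univ x)
        have h2 : |x - y| ≤ |x - y| ^ (β - m) := by
          simpa using Real.rpow_le_rpow_of_exponent_ge hpos h1 hα1
        calc _ ≤ B (m + 1) * |x - y| := hlip
          _ ≤ B (m + 1) * |x - y| ^ (β - m) := by gcongr; exact hB0 _
          _ ≤ _ := by gcongr; linarith [hB0 m]
      · have h2 : 1 ≤ |x - y| ^ (β - m) := Real.one_le_rpow h1 hα.le
        calc _ ≤ ‖iteratedDeriv m b x‖ + ‖iteratedDeriv m b y‖ := norm_sub_le _ _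
          _ ≤ B (m + 1) + 2 * B m := by linarith [hB m x, hB m y, hB0 (m + 1)]
          _ ≤ _ := le_mul_of_one_le_right (by linarith [hB0 m, hB0 (m + 1)]) h2
  · exact (b.continuous.memLp_of_hasCompactSupport b.hasCompactSupport).2.ne

end Holder

/-! ### Lower bounds on the variance -/

section Bounds

variable {Ω : Type*} [MeasurableSpace Ω] {P : Measure Ω} {W : ℝ≥0 → Ω → ℝ} {β R x₀ n : ℝ}

theorem sinh_le_mul_exp (x : ℝ) : Real.sinh x ≤ x * Real.exp x := by
  have h1 := Real.add_one_le_exp (-(2 * x))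
  have h2 : Real.exp (-x) = Real.exp x * Real.exp (-(2 * x)) := by
    rw [← Real.exp_add]; ring_nf
  rw [Real.sinh_eq, h2]
  nlinarith [Real.exp_pos x]

theorem intervalIntegrable_of_mem_holderBall {f : ℝ → ℝ} (hf : f ∈ holderBall β R) :
    IntervalIntegrable f volume 0 1 := by
  have h : ContinuousOn f (Icc 0 1) :=
    (contDiffOn_of_holderNorm_lt_top (lt_of_le_of_lt hf ENNReal.ofReal_lt_top)).continuousOn
  exact ContinuousOn.intervalIntegrable (by rwa [uIcc_of_le zero_le_one])

theorem neg_bump (K : ℝ → ℝ) (β x₀ h V : ℝ) : -bump K β x₀ h V = bump K β x₀ h (-V) := by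
  funext x
  simp [bump]

theorem bump_add_bump (K : ℝ → ℝ) (β x₀ h V V' : ℝ) :
    bump K β x₀ h V + bump K β x₀ h V' = bump K β x₀ h (V + V') := by
  funext x
  simp only [bump, Pi.add_apply]
  ring

theorem add_bump_mem_holderBall (hβ : 0 < β) {K : ℝ → ℝ} (hK : K ∈ kernels β) {f : ℝ → ℝ} {V : ℝ}
    (hfV : holderNorm (Icc 0 1) β f + ENNReal.ofReal |V| * holderNorm univ β K ≤ ENNReal.ofReal R)
    (x₀ : ℝ) {h : ℝ} (hh : 0 < h) (hh1 : h ≤ 1) : f + bump K β x₀ h V ∈ holderBall β R :=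
  (holderNorm_add_le (uniqueDiffOn_Icc zero_lt_one) _ _).trans
    ((add_le_add_right (holderNorm_bump_le hβ hK x₀ V hh hh1) _).trans hfV)

theorem bump_mem_holderBall (hβ : 0 < β) {K : ℝ → ℝ} (hK : K ∈ kernels β) {V : ℝ}
    (hV : ENNReal.ofReal |V| * holderNorm univ β K ≤ ENNReal.ofReal R)
    (x₀ : ℝ) {h : ℝ} (hh : 0 < h) (hh1 : h ≤ 1) : bump K β x₀ h V ∈ holderBall β R :=
  (holderNorm_bump_le hβ hK x₀ V hh hh1).trans hV

theorem enorm_sq_integral_bump_sub_le (hW : IsBrownianReal W P) (hn : 0 < n) {K : ℝ → ℝ}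
    (hK : K ∈ kernels β) (hK2 : eLpNorm K 2 volume ≠ ∞) {f : ℝ → ℝ}
    (hf : IntervalIntegrable f volume 0 1) {T : (I → ℝ) → ℝ} (hT : Measurable T) (x₀ : ℝ)
    {h V : ℝ} (hh : 0 < h) (hV : V ≠ 0) :
    ‖(∫ y, T y ∂(law P W n (f + bump K β x₀ h V))) -
      ∫ y, T y ∂(law P W n (f - bump K β x₀ h V))‖ₑ ^ 2 ≤ var P W n T f * ENNReal.ofReal
        (4 * Real.sinh (n * (V ^ 2 * h ^ (2 * β + 1) * (eLpNorm K 2 volume).toReal ^ 2))) := by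
  have hL := ENNReal.toReal_pos (eLpNorm_ne_zero_of_mem_kernels hK) hK2
  have hKc := continuous_of_mem_kernels hK
  have hp := Real.rpow_pos_of_pos hh (2 * β + 1)
  refine enorm_sq_integral_law_sub_le hW hn hf (continuous_bump hKc _ _ _ _) hT (by positivity) ?_
  gcongr
  exact integral_bump_sq_le hKc hK2 β x₀ V hh

theorem abs_sub_le_of_absBias_le {T : (I → ℝ) → ℝ} {f : ℝ → ℝ} {b : ℝ} (hb : 0 ≤ b)
    (h : absBias P W n x₀ T f ≤ ENNReal.ofReal b) :
    |(∫ y, T y ∂(law P W n f)) - f x₀| ≤ b := by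
  rw [absBias, ← ofReal_norm, Real.norm_eq_abs] at h
  exact (ENNReal.ofReal_le_ofReal_iff hb).1 h

/-- Lower bound on the variance at a given parameter. -/
theorem ofReal_sq_le_var_mul_sinh (hW : IsBrownianReal W P) (hβ : 0 < β) (hn : 0 < n) {K : ℝ → ℝ}
    (hK : K ∈ kernels β) (hK2 : eLpNorm K 2 volume ≠ ∞) {f : ℝ → ℝ}
    (hf : f ∈ holderBall β R) {T : (I → ℝ) → ℝ} (hT : Measurable T)
    {h V b : ℝ} (hh : 0 < h) (hh1 : h ≤ 1) (hV : 0 < V)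
    (hfV : holderNorm (Icc 0 1) β f + ENNReal.ofReal V * holderNorm univ β K ≤ ENNReal.ofReal R)
    (hb : 0 ≤ b) (hbV : b ≤ V * h ^ β)
    (hbias : ∀ f ∈ holderBall β R, absBias P W n x₀ T f ≤ ENNReal.ofReal b) :
    ENNReal.ofReal ((V * h ^ β - b) ^ 2) ≤ var P W n T f * ENNReal.ofReal
        (Real.sinh (n * (V ^ 2 * h ^ (2 * β + 1) * (eLpNorm K 2 volume).toReal ^ 2))) := by
  have key := enorm_sq_integral_bump_sub_le hW hn hK hK2 (intervalIntegrable_of_mem_holderBall hf)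
    hT x₀ hh hV.ne'
  have hp : f + bump K β x₀ h V ∈ holderBall β R :=
    add_bump_mem_holderBall hβ hK (by rwa [abs_of_pos hV]) x₀ hh hh1
  have hm : f - bump K β x₀ h V ∈ holderBall β R := by
    rw [sub_eq_add_neg, neg_bump]
    exact add_bump_mem_holderBall hβ hK (by rwa [abs_neg, abs_of_pos hV]) x₀ hh hh1
  have h1 := abs_sub_le_of_absBias_le hb (hbias _ hp)
  have h2 := abs_sub_le_of_absBias_le hb (hbias _ hm)
  simp only [Pi.add_apply, Pi.sub_apply, bump_center hK.2] at h1 h2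
  set Ep := ∫ y, T y ∂(law P W n (f + bump K β x₀ h V))
  set Em := ∫ y, T y ∂(law P W n (f - bump K β x₀ h V))
  -- The values at `x₀` differ by `2 V h^β`, and each bias absorbs at most `b`.
  have h3 : 4 * (V * h ^ β - b) ^ 2 ≤ (Ep - Em) ^ 2 := by
    have : 2 * (V * h ^ β - b) ≤ Ep - Em := by
      linarith [(abs_le.1 h1).1, (abs_le.1 h2).2]
    calc 4 * (V * h ^ β - b) ^ 2 = (2 * (V * h ^ β - b)) ^ 2 := by ring
      _ ≤ _ := by gcongr
  have h4 : ENNReal.ofReal 4 * ENNReal.ofReal ((V * h ^ β - b) ^ 2) ≤ ‖Ep - Em‖ₑ ^ 2 := by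
    rw [← ENNReal.ofReal_mul (by norm_num), ← ofReal_norm, ← ENNReal.ofReal_pow (norm_nonneg _),
      Real.norm_eq_abs, sq_abs]
    exact ENNReal.ofReal_le_ofReal h3
  have h5 := h4.trans key
  rw [ENNReal.ofReal_mul (by norm_num), mul_left_comm] at h5
  exact (ENNReal.mul_le_mul_iff_right (by simp) ENNReal.ofReal_ne_top).1 h5

/-- Lower bound on the worst-case variance, obtained by summing along a segment of parameters. -/
theorem sq_le_mul_of_var_le (hW : IsBrownianReal W P) (hβ : 0 < β) (hn : 0 < n) {K : ℝ → ℝ}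
    (hK : K ∈ kernels β) (hK2 : eLpNorm K 2 volume ≠ ∞) {T : (I → ℝ) → ℝ} (hT : Measurable T)
    {h V b M : ℝ} (hh : 0 < h) (hh1 : h ≤ 1) (hV : 0 < V)
    (hVR : ENNReal.ofReal V * holderNorm univ β K ≤ ENNReal.ofReal R)
    (hb : 0 ≤ b) (hbV : b ≤ V * h ^ β) (hM : 0 ≤ M)
    (hbias : ∀ f ∈ holderBall β R, absBias P W n x₀ T f ≤ ENNReal.ofReal b)
    (hvar : ∀ f ∈ holderBall β R, var P W n T f ≤ ENNReal.ofReal M) :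
    (V * h ^ β - b) ^ 2 ≤
      M * (n * (V ^ 2 * h ^ (2 * β + 1) * (eLpNorm K 2 volume).toReal ^ 2)) := by
  have hL := ENNReal.toReal_pos (eLpNorm_ne_zero_of_mem_kernels hK) hK2
  have hp := Real.rpow_pos_of_pos hh (2 * β + 1)
  set a := n * (V ^ 2 * h ^ (2 * β + 1) * (eLpNorm K 2 volume).toReal ^ 2) with hadef
  have ha : 0 < a := by positivity
  let E : ℝ → ℝ := fun θ => ∫ y, T y ∂(law P W n (bump K β x₀ h (V * θ)))
  have hmem : ∀ θ ∈ Icc (-1 : ℝ) 1, bump K β x₀ h (V * θ) ∈ holderBall β R := fun θ hθ => by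
    refine bump_mem_holderBall hβ hK (le_trans ?_ hVR) x₀ hh hh1
    gcongr
    rw [abs_mul, abs_of_pos hV]
    exact mul_le_of_le_one_right hV.le (abs_le.2 hθ)
  have hbd : ∀ N : ℕ, (V * h ^ β - b) ^ 2 ≤ M * (a * Real.exp (a / ((N : ℝ) + 1) ^ 2)) := by
    intro N
    set q : ℝ := (N : ℝ) + 1 with hq
    have hq0 : 0 < q := by positivity
    -- The segment `θ ∈ [-1, 1]` is cut into `q = N + 1` pieces of half-width `1/q`. The two-point
    -- inequality is used at each midpoint, where the amplitude `V/q` turns `a` into `a / q²`; the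
    -- differences then telescope.
    have hstep : ∀ i ∈ Finset.range (N + 1), E (-1 + 2 * ((i + 1 : ℕ) : ℝ) / q) -
        E (-1 + 2 * (i : ℝ) / q) ≤ √(M * (4 * Real.sinh (a / q ^ 2))) := by
      intro i hi
      have hiN : (i : ℝ) + 1 ≤ q := by
        rw [hq]
        have : i + 1 ≤ N + 1 := Finset.mem_range.1 hi
        exact_mod_cast this
      have hmid : -1 + (2 * (i : ℝ) + 1) / q ∈ Icc (-1 : ℝ) 1 := by
        constructor
        · have : 0 ≤ (2 * (i : ℝ) + 1) / q := by positivity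
          linarith
        · have : (2 * (i : ℝ) + 1) / q ≤ 2 := by
            rw [div_le_iff₀ hq0]; linarith
          linarith
      have key := enorm_sq_integral_bump_sub_le hW hn hK hK2
        (intervalIntegrable_of_mem_holderBall (hmem _ hmid)) hT x₀ hh (V := V / q)
        (div_pos hV hq0).ne'
      rw [sub_eq_add_neg (bump K β x₀ h _), neg_bump, bump_add_bump, bump_add_bump] at key
      have e1 : V * (-1 + (2 * (i : ℝ) + 1) / q) + V / q =
          V * (-1 + 2 * ((i + 1 : ℕ) : ℝ) / q) := by push_cast; field_simp; ring
      have e2 : V * (-1 + (2 * (i : ℝ) + 1) / q) + -(V / q) = V * (-1 + 2 * (i : ℝ) / q) := by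
        field_simp; ring
      have e3 : n * ((V / q) ^ 2 * h ^ (2 * β + 1) * (eLpNorm K 2 volume).toReal ^ 2) =
          a / q ^ 2 := by rw [hadef]; field_simp
      rw [e1, e2, e3] at key
      have hs : 0 ≤ 4 * Real.sinh (a / q ^ 2) := by
        have := Real.sinh_nonneg_iff.2 (by positivity : 0 ≤ a / q ^ 2)
        positivity
      have key2 := key.trans (mul_le_mul_left (hvar _ (hmem _ hmid)) _)
      rw [← ENNReal.ofReal_mul hM, ← ofReal_norm, ← ENNReal.ofReal_pow (norm_nonneg _),
        Real.norm_eq_abs, sq_abs, ENNReal.ofReal_le_ofReal_iff (by positivity)] at key2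
      exact Real.le_sqrt_of_sq_le key2
    have hsum := Finset.sum_le_sum hstep
    rw [Finset.sum_range_sub (fun i : ℕ => E (-1 + 2 * (i : ℝ) / q)), Finset.sum_const,
      Finset.card_range, nsmul_eq_mul] at hsum
    have hq1 : -1 + 2 * ((N + 1 : ℕ) : ℝ) / q = 1 := by
      rw [hq]; push_cast; field_simp; norm_num
    have hq2 : -1 + 2 * ((0 : ℕ) : ℝ) / q = -1 := by simp
    rw [hq1, hq2] at hsum
    have h1 := abs_sub_le_of_absBias_le hb (hbias _ (hmem 1 (by norm_num)))
    have h2 := abs_sub_le_of_absBias_le hb (hbias _ (hmem (-1) (by norm_num)))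
    rw [bump_center hK.2] at h1 h2
    have h3 : 2 * (V * h ^ β - b) ≤ q * √(M * (4 * Real.sinh (a / q ^ 2))) := by
      refine le_trans ?_ (hsum.trans_eq (by rw [hq]; push_cast; rfl))
      simp only [E]
      linarith [(abs_le.1 h1).1, (abs_le.1 h2).2]
    have hs0 : 0 ≤ Real.sinh (a / q ^ 2) := Real.sinh_nonneg_iff.2 (by positivity)
    have h4 : (2 * (V * h ^ β - b)) ^ 2 ≤ q ^ 2 * (M * (4 * Real.sinh (a / q ^ 2))) := by
      calc _ ≤ (q * √(M * (4 * Real.sinh (a / q ^ 2)))) ^ 2 := by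
            gcongr
        _ = _ := by rw [mul_pow, Real.sq_sqrt (by positivity)]
    have h5 : q ^ 2 * Real.sinh (a / q ^ 2) ≤ a * Real.exp (a / q ^ 2) := by
      calc q ^ 2 * Real.sinh (a / q ^ 2) ≤ q ^ 2 * (a / q ^ 2 * Real.exp (a / q ^ 2)) := by
            gcongr; exact sinh_le_mul_exp _
        _ = _ := by field_simp
    have h6 := mul_le_mul_of_nonneg_left h5 hM
    linarith
  -- Refining the partition sends the exponential factor to `1`.
  have hlim : Tendsto (fun N : ℕ => M * (a * Real.exp (a / ((N : ℝ) + 1) ^ 2))) atTop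
      (𝓝 (M * (a * Real.exp 0))) := by
    refine ((Real.continuous_exp.tendsto _).comp ?_).const_mul a |>.const_mul M
    refine Tendsto.const_div_atTop ?_ a
    exact (tendsto_pow_atTop two_ne_zero).comp
      (tendsto_atTop_add_const_right atTop (1 : ℝ) tendsto_natCast_atTop_atTop)
  rw [Real.exp_zero, mul_one] at hlim
  exact ge_of_tendsto' hlim hbd

theorem ofReal_toReal_holderNorm {K : ℝ → ℝ} (hK : K ∈ kernels β) :
    ENNReal.ofReal (holderNorm univ β K).toReal = holderNorm univ β K :=
  ENNReal.ofReal_toReal hK.1.ne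

theorem one_le_toReal_holderNorm {K : ℝ → ℝ} (hK : K ∈ kernels β) :
    1 ≤ (holderNorm univ β K).toReal := by
  simpa using ENNReal.toReal_mono hK.1.ne (one_le_holderNorm hK)

/-- Real form of the terms of the suprema, for kernels with norm below the radius. -/
theorem kernel_term_eq {K : ℝ → ℝ} (hK : K ∈ kernels β) (hK2 : eLpNorm K 2 volume ≠ ∞) {r : ℝ}
    (hr : (holderNorm univ β K).toReal < r) :
    ((eLpNorm K 2 volume)⁻¹ * (1 - holderNorm univ β K / ENNReal.ofReal r)) ^ 2 =
      ENNReal.ofReal (((eLpNorm K 2 volume).toReal⁻¹ *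
        (1 - (holderNorm univ β K).toReal / r)) ^ 2) := by
  have hL := ENNReal.toReal_pos (eLpNorm_ne_zero_of_mem_kernels hK) hK2
  have hN := one_le_toReal_holderNorm hK
  have hr0 : 0 < r := by linarith
  have h1 : 0 ≤ 1 - (holderNorm univ β K).toReal / r := by
    rw [sub_nonneg, div_le_one hr0]; exact hr.le
  rw [ENNReal.ofReal_pow (by positivity), ENNReal.ofReal_mul (by positivity),
    ENNReal.ofReal_inv_of_pos hL, ENNReal.ofReal_toReal hK2, ENNReal.ofReal_sub _ (by positivity),
    ENNReal.ofReal_div_of_pos hr0, ofReal_toReal_holderNorm hK, ENNReal.ofReal_one]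

theorem kernel_term_eq_zero {K : ℝ → ℝ} (hK : K ∈ kernels β) {r : ℝ}
    (hr : eLpNorm K 2 volume = ∞ ∨ r ≤ (holderNorm univ β K).toReal) :
    ((eLpNorm K 2 volume)⁻¹ * (1 - holderNorm univ β K / ENNReal.ofReal r)) ^ 2 = 0 := by
  rcases hr with hr | hr
  · simp [hr]
  · have hN : 1 ≤ holderNorm univ β K / ENNReal.ofReal r := by
      have h1 : ENNReal.ofReal r ≤ holderNorm univ β K := by
        rw [← ofReal_toReal_holderNorm hK]
        exact ENNReal.ofReal_le_ofReal hr
      -- For `r ≤ 0` the quotient is `∞`, since kernels have norm at least `1`.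
      rcases eq_or_ne (ENNReal.ofReal r) 0 with h0 | h0
      · rw [h0, ENNReal.div_zero (by have := one_le_holderNorm hK; positivity)]
        exact le_top
      · exact (ENNReal.le_div_iff_mul_le (Or.inl h0) (Or.inl ENNReal.ofReal_ne_top)).2
          (by rwa [one_mul])
    rw [tsub_eq_zero_of_le hN, mul_zero, zero_pow two_ne_zero]

theorem gamma_le_of_var_le (hW : IsBrownianReal W P) (hβ : 0 < β) (hn : 0 < n)
    {T : (I → ℝ) → ℝ} (hT : Measurable T) {h M : ℝ} (hh : 0 < h) (hh1 : h ≤ 1) (hM : 0 ≤ M)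
    (hbias : ∀ f ∈ holderBall β R, absBias P W n x₀ T f ≤ ENNReal.ofReal (h ^ β))
    (hvar : ∀ f ∈ holderBall β R, var P W n T f ≤ ENNReal.ofReal M) :
    gamma R β ≤ ENNReal.ofReal (n * (h * M)) := by
  refine iSup₂_le fun K hK => ?_
  by_cases hz : eLpNorm K 2 volume = ∞ ∨ R ≤ (holderNorm univ β K).toReal
  · rw [kernel_term_eq_zero hK hz]
    exact zero_le
  push Not at hz
  obtain ⟨hK2, hKR⟩ := hz
  have hL := ENNReal.toReal_pos (eLpNorm_ne_zero_of_mem_kernels hK) hK2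
  have hN := one_le_toReal_holderNorm hK
  rw [kernel_term_eq hK hK2 hKR]
  refine ENNReal.ofReal_le_ofReal ?_
  set N := (holderNorm univ β K).toReal with hNdef
  set L := (eLpNorm K 2 volume).toReal
  have hN0 : 0 < N := by linarith
  have hR : 0 < R := by linarith
  have hhβ := Real.rpow_pos_of_pos hh β
  have hV1 : 1 ≤ R / N := by rw [le_div_iff₀ hN0]; linarith
  -- `V = R / N` is the largest amplitude for which the norm bound keeps the bump in the ball. With
  -- `b = h^β` the powers of `h` cancel except for one factor `h`.
  have key := sq_le_mul_of_var_le hW hβ hn hK hK2 hT hh hh1 (div_pos hR hN0) (R := R) (V := R / N)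
    (by
      rw [← ofReal_toReal_holderNorm hK, ← ENNReal.ofReal_mul (by positivity), ← hNdef,
        div_mul_cancel₀ _ hN0.ne']) hhβ.le (le_mul_of_one_le_left hhβ.le hV1) hM hbias hvar
  have hpow : h ^ (2 * β + 1) = (h ^ β) ^ 2 * h := by
    rw [Real.rpow_add hh, Real.rpow_one, mul_comm 2 β, Real.rpow_mul hh.le, Real.rpow_two]
  rw [hpow] at key
  have e1 : (R / N * h ^ β - h ^ β) ^ 2 =
      (L⁻¹ * (1 - N / R)) ^ 2 * ((R / N) ^ 2 * (h ^ β) ^ 2 * L ^ 2) := by field_simp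
  have e2 : M * (n * ((R / N) ^ 2 * ((h ^ β) ^ 2 * h) * L ^ 2)) =
      (n * (h * M)) * ((R / N) ^ 2 * (h ^ β) ^ 2 * L ^ 2) := by ring
  rw [e1, e2] at key
  exact le_of_mul_le_mul_right key (by positivity)

theorem gammaBar_le_var_mul (hW : IsBrownianReal W P) (hβ : 0 < β) (hn : 0 < n)
    {T : (I → ℝ) → ℝ} (hT : Measurable T) {C h : ℝ} (hh : 0 < h) (hh1 : h ≤ 1)
    (hhC : n * h ^ (2 * β + 1) ≤ C)
    (hbias : ∀ f ∈ holderBall β R, absBias P W n x₀ T f ≤ ENNReal.ofReal (h ^ β))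
    {f : ℝ → ℝ} (hf : f ∈ holderBall β R) :
    gammaBar R β C (holderNorm (Icc 0 1) β f).toReal ≤ var P W n T f * ENNReal.ofReal (n * h) := by
  refine iSup₂_le fun K hK => ?_
  have hffin : holderNorm (Icc 0 1) β f ≠ ∞ := (lt_of_le_of_lt hf ENNReal.ofReal_lt_top).ne
  have hffin' := ENNReal.ofReal_toReal hffin
  set a := (holderNorm (Icc 0 1) β f).toReal with hadef
  by_cases hz : eLpNorm K 2 volume = ∞ ∨ R - a ≤ (holderNorm univ β K).toReal
  · rw [kernel_term_eq_zero hK hz, zero_mul]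
    exact zero_le
  push Not at hz
  obtain ⟨hK2, hKR⟩ := hz
  have hL := ENNReal.toReal_pos (eLpNorm_ne_zero_of_mem_kernels hK) hK2
  have hN := one_le_toReal_holderNorm hK
  rw [kernel_term_eq hK hK2 hKR, ← ENNReal.ofReal_mul (sq_nonneg _)]
  rcases eq_or_ne (var P W n T f) ∞ with hv | hv
  · rw [hv, ENNReal.top_mul (by simpa using mul_pos hn hh)]
    exact le_top
  have hv' := ENNReal.ofReal_toReal hv
  set v := (var P W n T f).toReal
  have hv0 : 0 ≤ v := ENNReal.toReal_nonneg
  rw [← hv', ← ENNReal.ofReal_mul hv0]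
  refine ENNReal.ofReal_le_ofReal ?_
  have hNe := ofReal_toReal_holderNorm hK
  set N := (holderNorm univ β K).toReal with hNdef
  set r := R - a with hrdef
  have hN0 : 0 < N := by linarith
  have hr : 0 < r := by linarith
  have hhβ := Real.rpow_pos_of_pos hh β
  have hV1 : 1 ≤ r / N := by rw [le_div_iff₀ hN0]; linarith
  have key := ofReal_sq_le_var_mul_sinh hW hβ hn hK hK2 hf hT hh hh1 (div_pos hr hN0) (V := r / N)
    (by
      rw [← hNe, ← ENNReal.ofReal_mul (by positivity), ← hffin',
        div_mul_cancel₀ _ hN0.ne', ← ENNReal.ofReal_add ENNReal.toReal_nonneg hr.le]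
      rw [← hadef, hrdef, add_sub_cancel]) hhβ.le (le_mul_of_one_le_left hhβ.le hV1) hbias
  set L := (eLpNorm K 2 volume).toReal
  set A := n * ((r / N) ^ 2 * h ^ (2 * β + 1) * L ^ 2) with hA
  have hhp := Real.rpow_pos_of_pos hh (2 * β + 1)
  have hA0 : 0 < A := by positivity
  -- The assumption `n h^(2β+1) ≤ C` bounds the argument of `sinh` by the exponent in `gammaBar`.
  have hAE : A ≤ C * r ^ 2 * (L ^ 2 / N ^ 2) := by
    calc A = (n * h ^ (2 * β + 1)) * (r ^ 2 * (L ^ 2 / N ^ 2)) := by rw [hA, div_pow]; ring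
      _ ≤ C * (r ^ 2 * (L ^ 2 / N ^ 2)) := by gcongr
      _ = _ := by ring
  set E := C * r ^ 2 * (L ^ 2 / N ^ 2)
  have hsinh0 := Real.sinh_nonneg_iff.2 hA0.le
  rw [← hv', ← ENNReal.ofReal_mul hv0, ENNReal.ofReal_le_ofReal_iff (by positivity)] at key
  have key2 : (r / N * h ^ β - h ^ β) ^ 2 ≤ v * (A * Real.exp E) := by
    refine key.trans ?_
    gcongr
    refine (sinh_le_mul_exp _).trans ?_
    gcongr
  have hpow : h ^ (2 * β + 1) = (h ^ β) ^ 2 * h := by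
    rw [Real.rpow_add hh, Real.rpow_one, mul_comm 2 β, Real.rpow_mul hh.le, Real.rpow_two]
  have e1 : (r / N * h ^ β - h ^ β) ^ 2 =
      (L⁻¹ * (1 - N / r)) ^ 2 * ((r / N) ^ 2 * (h ^ β) ^ 2 * L ^ 2) := by field_simp
  have e2 : v * (A * Real.exp E) =
      (v * (n * h) * Real.exp E) * ((r / N) ^ 2 * (h ^ β) ^ 2 * L ^ 2) := by
    rw [hA, hpow]; ring
  rw [e1, e2] at key2
  have key3 := le_of_mul_le_mul_right key2 (by positivity)
  rw [Real.exp_neg, ← div_eq_mul_inv, div_le_iff₀ (Real.exp_pos _)]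
  exact key3

end Bounds

/-! ### Finiteness of the constants -/

section Finite

variable {β : ℝ}

theorem abs_sub_one_le_of_strictFloor_eq_zero (hm : strictFloor β = 0) {K : ℝ → ℝ}
    (hK : K ∈ kernels β) {x : ℝ} (hx : x ≠ 0) :
    |K x - 1| ≤ (holderNorm univ β K).toReal * |x| ^ β := by
  have hKc := contDiff_of_mem_kernels hK
  have hxp : 0 < |x| ^ β := Real.rpow_pos_of_pos (abs_pos.2 hx) _
  have h : ‖K x - K 0‖ₑ / ENNReal.ofReal (|x - 0| ^ (β - (0 : ℕ))) ≤ holderNorm univ β K := by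
    simp only [holderNorm, if_pos hKc.contDiffOn, iteratedDerivWithin_univ]
    refine le_add_left ?_
    refine le_iSup₂_of_le x (mem_univ _) (le_iSup₂_of_le 0 (mem_univ _) (le_iSup_of_le hx ?_))
    rw [hm, iteratedDeriv_zero]
  rw [hK.2, sub_zero, Nat.cast_zero, sub_zero, ← ofReal_norm, ← ENNReal.ofReal_div_of_pos hxp,
    ← ofReal_toReal_holderNorm hK, ENNReal.ofReal_le_ofReal_iff ENNReal.toReal_nonneg,
    div_le_iff₀ hxp] at h
  exact h

theorem abs_sub_one_le_of_strictFloor_pos (hm : 1 ≤ strictFloor β) {K : ℝ → ℝ}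
    (hK : K ∈ kernels β) (x : ℝ) : |K x - 1| ≤ (holderNorm univ β K).toReal * |x| := by
  have hKc := contDiff_of_mem_kernels hK
  have hd : ∀ y, ‖deriv K y‖ ≤ (holderNorm univ β K).toReal := fun y => by
    have h : ‖deriv K y‖ₑ ≤ holderNorm univ β K := by
      simp only [holderNorm, if_pos hKc.contDiffOn, iteratedDerivWithin_univ]
      refine le_add_right ?_
      refine le_trans ?_ (Finset.single_le_sum (f := fun l =>
        ⨆ x ∈ univ, ‖iteratedDeriv l K x‖ₑ) (fun _ _ => zero_le)
        (Finset.mem_range.2 (Nat.lt_succ_iff.2 hm)))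
      exact le_iSup₂_of_le y (mem_univ _) (by rw [iteratedDeriv_one])
    rw [← ofReal_norm, ← ofReal_toReal_holderNorm hK,
      ENNReal.ofReal_le_ofReal_iff ENNReal.toReal_nonneg] at h
    exact h
  have hdiff : Differentiable ℝ K := hKc.differentiable (by
    have : strictFloor β ≠ 0 := by omega
    exact_mod_cast this)
  have := convex_univ.norm_image_sub_le_of_norm_deriv_le (f := K) (fun z _ => hdiff z)
    (fun z _ => hd z) (mem_univ 0) (mem_univ x)
  simpa [hK.2] using this

/-- A Hölder bound makes the kernels equicontinuous at `0`, where they all equal `1`. For `β ≤ 1`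
this is the Hölder quotient itself; for `β > 1` it is the bound on the first derivative. -/
theorem exists_pos_half_le_abs (hβ : 0 < β) (R : ℝ) : ∃ δ : ℝ, 0 < δ ∧ ∀ K ∈ kernels β,
    (holderNorm univ β K).toReal ≤ R → ∀ x ∈ Icc (-δ) δ, 1 / 2 ≤ |K x| := by
  set r := max R 1
  have hr : 0 < r := lt_of_lt_of_le one_pos (le_max_right _ _)
  suffices h : ∃ δ : ℝ, 0 < δ ∧ ∀ K ∈ kernels β,
      (holderNorm univ β K).toReal ≤ R → ∀ x, x ≠ 0 → |x| ≤ δ → |K x - 1| ≤ 1 / 2 by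
    obtain ⟨δ, hδ, H⟩ := h
    refine ⟨δ, hδ, fun K hK hKR x hx => ?_⟩
    rcases eq_or_ne x 0 with rfl | hx0
    · rw [hK.2]; norm_num
    · have h1 := H K hK hKR x hx0 (abs_le.2 hx)
      have h2 := abs_le.1 h1
      exact le_trans (by linarith) (le_abs_self _)
  rcases Nat.eq_zero_or_pos (strictFloor β) with hm | hm
  · refine ⟨(1 / (2 * r)) ^ (1 / β), by positivity, fun K hK hKR x hx hxδ => ?_⟩
    refine (abs_sub_one_le_of_strictFloor_eq_zero hm hK hx).trans ?_
    calc (holderNorm univ β K).toReal * |x| ^ β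
        ≤ r * ((1 / (2 * r)) ^ (1 / β)) ^ β := by
          gcongr
          exact hKR.trans (le_max_left _ _)
      _ = 1 / 2 := by
          rw [← Real.rpow_mul (by positivity), one_div_mul_cancel hβ.ne', Real.rpow_one]
          field_simp
  · refine ⟨1 / (2 * r), by positivity, fun K hK hKR x hx hxδ => ?_⟩
    refine (abs_sub_one_le_of_strictFloor_pos hm hK x).trans ?_
    calc (holderNorm univ β K).toReal * |x| ≤ r * (1 / (2 * r)) := by
          gcongr
          exact hKR.trans (le_max_left _ _)
      _ = 1 / 2 := by field_simp

/-- Kernels with a nonzero term stay above `1/2` in absolute value on a common interval, so their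
`L²` norms are bounded below. -/
theorem gamma_lt_top (hβ : 0 < β) (R : ℝ) : gamma R β < ∞ := by
  obtain ⟨δ, hδ, H⟩ := exists_pos_half_le_abs hβ R
  let c : ℝ≥0∞ := eLpNorm ((Icc (-δ) δ).indicator fun _ => (1 / 2 : ℝ)) 2 volume
  have hc : c ≠ 0 := by
    simp only [c]
    rw [eLpNorm_indicator_const measurableSet_Icc two_ne_zero ENNReal.ofNat_ne_top]
    simp [hδ]
  refine lt_of_le_of_lt (iSup₂_le fun K hK => ?_)
    (show (c⁻¹ * 1) ^ 2 < ∞ by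
      rw [mul_one]; exact ENNReal.pow_lt_top (ENNReal.inv_lt_top.2 (pos_iff_ne_zero.2 hc)))
  by_cases hz : eLpNorm K 2 volume = ∞ ∨ R ≤ (holderNorm univ β K).toReal
  · rw [kernel_term_eq_zero hK hz]
    exact zero_le
  push Not at hz
  have hcK : c ≤ eLpNorm K 2 volume := by
    refine eLpNorm_mono fun x => ?_
    by_cases hx : x ∈ Icc (-δ) δ
    · rw [indicator_of_mem hx]
      simpa using! H K hK hz.2.le x hx
    · rw [indicator_of_notMem hx]
      simp
  gcongr
  exact tsub_le_self

theorem gammaBar_lt_top (hβ : 0 < β) (R a : ℝ) {C : ℝ} (hC : 0 ≤ C) : gammaBar R β C a < ∞ := by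
  refine lt_of_le_of_lt (iSup₂_mono fun K _ => mul_le_of_le_one_right' ?_) (gamma_lt_top hβ (R - a))
  rw [ENNReal.ofReal_le_one, Real.exp_le_one_iff, neg_nonpos]
  positivity

end Finite

/-! ### Trade-off between bias and variance -/

section TradeOff

variable {Ω : Type*} [MeasurableSpace Ω] {P : Measure Ω} {W : ℝ≥0 → Ω → ℝ} {β R x₀ n : ℝ}

theorem absBias_le_of_iSup_rpow_le (hβ : 0 < β) {T : (I → ℝ) → ℝ} {h : ℝ} (hh : 0 < h)
    (hF : (⨆ f ∈ holderBall β R, absBias P W n x₀ T f ^ (1 / β)) ≤ ENNReal.ofReal h)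
    {f : ℝ → ℝ} (hf : f ∈ holderBall β R) :
    absBias P W n x₀ T f ≤ ENNReal.ofReal (h ^ β) := by
  have h1 : absBias P W n x₀ T f ^ (1 / β) ≤ ENNReal.ofReal h :=
    (le_iSup₂ (f := fun f _ => absBias P W n x₀ T f ^ (1 / β)) f hf).trans hF
  have h2 := ENNReal.rpow_le_rpow h1 hβ.le
  rwa [← ENNReal.rpow_mul, one_div_mul_cancel hβ.ne', ENNReal.rpow_one,
    ENNReal.ofReal_rpow_of_pos hh] at h2

theorem iSup_rpow_lt {T : (I → ℝ) → ℝ} (hβ : 0 < β) {b : ℝ≥0∞}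
    (hb : (⨆ f ∈ holderBall β R, absBias P W n x₀ T f) < b) :
    (⨆ f ∈ holderBall β R, absBias P W n x₀ T f ^ (1 / β)) < b ^ (1 / β) := by
  refine lt_of_le_of_lt (iSup₂_le fun f hf => ?_) (ENNReal.rpow_lt_rpow hb (by positivity))
  exact ENNReal.rpow_le_rpow (le_iSup₂ (f := fun f _ => absBias P W n x₀ T f) f hf) (by positivity)

theorem gamma_div_le_mulTop (hW : IsBrownianReal W P) (hβ : 0 < β) (hn : 0 < n)
    {T : (I → ℝ) → ℝ} (hT : T ∈ classT P W n β R x₀) :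
    gamma R β / ENNReal.ofReal n ≤
      mulTop (⨆ f ∈ holderBall β R, absBias P W n x₀ T f ^ (1 / β))
        (⨆ f ∈ holderBall β R, var P W n T f) := by
  have hF := iSup_rpow_lt hβ hT.2
  rw [ENNReal.one_rpow] at hF
  set F := ⨆ f ∈ holderBall β R, absBias P W n x₀ T f ^ (1 / β)
  set S := ⨆ f ∈ holderBall β R, var P W n T f
  by_cases hSt : S = ∞
  · simp [mulTop, hSt]
  have hFt : F ≠ ∞ := (hF.trans ENNReal.one_lt_top).ne
  rw [mulTop, if_neg (by simp [hSt, hFt]),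
    ENNReal.div_le_iff (by simpa using hn) ENNReal.ofReal_ne_top]
  have hF1 : F.toReal < 1 := by
    simpa using (ENNReal.toReal_lt_toReal hFt ENNReal.one_ne_top).2 hF
  -- The worst-case bias may vanish, while a bandwidth must be positive; hence `h` decreases to `F`
  -- from the right.
  have hlim : Tendsto (fun h : ℝ => ENNReal.ofReal (n * (h * S.toReal))) (𝓝[>] F.toReal)
      (𝓝 (ENNReal.ofReal (n * (F.toReal * S.toReal)))) :=
    ((ENNReal.continuous_ofReal.comp (by fun_prop)).tendsto _).mono_left nhdsWithin_le_nhds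
  have hle : gamma R β ≤ ENNReal.ofReal (n * (F.toReal * S.toReal)) := by
    refine ge_of_tendsto hlim ?_
    filter_upwards [Ioo_mem_nhdsGT hF1] with h hh
    have hh0 : 0 < h := lt_of_le_of_lt ENNReal.toReal_nonneg hh.1
    refine gamma_le_of_var_le hW hβ hn hT.1.1 hh0 hh.2.le ENNReal.toReal_nonneg
      (x₀ := x₀) (fun f hf => absBias_le_of_iSup_rpow_le hβ hh0 ?_ hf) (fun f hf => ?_)
    · exact (ENNReal.ofReal_toReal hFt).symm.le.trans (ENNReal.ofReal_le_ofReal hh.1.le)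
    · rw [ENNReal.ofReal_toReal hSt]
      exact le_iSup₂ (f := fun f _ => var P W n T f) f hf
  rw [ENNReal.ofReal_mul hn.le, ENNReal.ofReal_mul ENNReal.toReal_nonneg,
    ENNReal.ofReal_toReal hFt, ENNReal.ofReal_toReal hSt, mul_comm] at hle
  exact hle

theorem one_div_le_mulTop (hW : IsBrownianReal W P) (hβ : 0 < β) (hn : 0 < n) {C : ℝ}
    (hC : 0 < C) {T : (I → ℝ) → ℝ} (hT : T ∈ classS P W n β R x₀ C) :
    1 / ENNReal.ofReal n ≤
      mulTop (⨆ f ∈ holderBall β R, absBias P W n x₀ T f ^ (1 / β))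
        (⨅ f ∈ holderBall β R, divTop (var P W n T f)
          (gammaBar R β C (holderNorm (Icc 0 1) β f).toReal)) := by
  have hF := iSup_rpow_lt hβ hT.2.2
  have hFC := iSup_rpow_lt hβ hT.1.2
  have hCn : 0 < C / n := by positivity
  rw [ENNReal.one_rpow] at hF
  rw [ENNReal.ofReal_rpow_of_pos (by positivity), ← Real.rpow_mul hCn.le] at hFC
  have hexp : β / (2 * β + 1) * (1 / β) = 1 / (2 * β + 1) := by field_simp
  rw [hexp] at hFC
  set F := ⨆ f ∈ holderBall β R, absBias P W n x₀ T f ^ (1 / β)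
  set G := ⨅ f ∈ holderBall β R, divTop (var P W n T f)
          (gammaBar R β C (holderNorm (Icc 0 1) β f).toReal)
  by_cases hGt : G = ∞
  · simp [mulTop, hGt]
  have hFt : F ≠ ∞ := (hF.trans ENNReal.one_lt_top).ne
  rw [mulTop, if_neg (by simp [hGt, hFt])]
  -- The first bound keeps `h ≤ 1`; the second is equivalent to `n h^(2β+1) ≤ C` at the bandwidth
  -- `h`.
  set η := min 1 ((C / n) ^ (1 / (2 * β + 1)))
  have hF1 : F.toReal < η := by
    refine lt_min ?_ ?_
    · simpa using (ENNReal.toReal_lt_toReal hFt ENNReal.one_ne_top).2 hF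
    · have := (ENNReal.toReal_lt_toReal hFt ENNReal.ofReal_ne_top).2 hFC
      rwa [ENNReal.toReal_ofReal (by positivity)] at this
  have hlim : Tendsto (fun h : ℝ => ENNReal.ofReal h * G) (𝓝[>] F.toReal)
      (𝓝 (ENNReal.ofReal F.toReal * G)) :=
    ENNReal.Tendsto.mul_const ((ENNReal.continuous_ofReal.tendsto _).mono_left nhdsWithin_le_nhds)
      (Or.inr hGt)
  rw [ENNReal.ofReal_toReal hFt] at hlim
  refine ge_of_tendsto hlim ?_
  filter_upwards [Ioo_mem_nhdsGT hF1] with h hh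
  have hh0 : 0 < h := lt_of_le_of_lt ENNReal.toReal_nonneg hh.1
  have hhe : ENNReal.ofReal h ≠ 0 := by simpa using hh0
  have hne : ENNReal.ofReal n ≠ 0 := by simpa using hn
  rw [mul_comm, ← ENNReal.div_le_iff hhe ENNReal.ofReal_ne_top]
  refine le_iInf₂ fun f hf => ?_
  by_cases hg : gammaBar R β C (holderNorm (Icc 0 1) β f).toReal = 0
  · simp [divTop, hg]
  rw [divTop, if_neg hg]
  have hhC : n * h ^ (2 * β + 1) ≤ C := by
    have h1 : h ^ (2 * β + 1) ≤ C / n := by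
      have h2 : h ≤ (C / n) ^ (1 / (2 * β + 1)) := hh.2.le.trans (min_le_right _ _)
      refine (Real.rpow_le_rpow hh0.le h2 (by positivity)).trans_eq ?_
      rw [← Real.rpow_mul hCn.le, one_div_mul_cancel (by positivity), Real.rpow_one]
    rw [le_div_iff₀ hn] at h1
    linarith
  have key := gammaBar_le_var_mul hW hβ hn hT.1.1.1 hh0 (hh.2.le.trans (min_le_left _ _)) hhC
    (x₀ := x₀) (R := R) (fun f hf => absBias_le_of_iSup_rpow_le hβ hh0
      ((ENNReal.ofReal_toReal hFt).symm.le.trans (ENNReal.ofReal_le_ofReal hh.1.le)) hf) hf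
  rw [ENNReal.le_div_iff_mul_le (Or.inl hg) (Or.inl (gammaBar_lt_top hβ R _ hC.le).ne)]
  rw [ENNReal.ofReal_mul hn.le] at key
  calc 1 / ENNReal.ofReal n / ENNReal.ofReal h *
        gammaBar R β C (holderNorm (Icc 0 1) β f).toReal
      ≤ 1 / ENNReal.ofReal n / ENNReal.ofReal h *
        (var P W n T f * (ENNReal.ofReal n * ENNReal.ofReal h)) := by gcongr
    _ = var P W n T f * ((ENNReal.ofReal n * (ENNReal.ofReal n)⁻¹) *
        (ENNReal.ofReal h * (ENNReal.ofReal h)⁻¹)) := by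
        rw [one_div, div_eq_mul_inv]; ring
    _ = var P W n T f := by
        rw [ENNReal.mul_inv_cancel hne ENNReal.ofReal_ne_top,
          ENNReal.mul_inv_cancel hhe ENNReal.ofReal_ne_top, mul_one, mul_one]

/-! ### Mean squared error -/

theorem memLp_two_of_mse_ne_top (hW : IsBrownianReal W P) {T : (I → ℝ) → ℝ} (hT : Measurable T)
    {f : ℝ → ℝ} (h : mse P W n x₀ T f ≠ ∞) : MemLp T 2 (law P W n f) := by
  have := isProbabilityMeasure_law hW n f
  have h1 : MemLp (fun y => T y - f x₀) 2 (law P W n f) := by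
    refine ⟨(hT.sub_const _).aestronglyMeasurable, ?_⟩
    rw [eLpNorm_lt_top_iff_lintegral_rpow_enorm_lt_top two_ne_zero ENNReal.ofNat_ne_top]
    simpa [mse] using lt_top_iff_ne_top.2 h
  have h2 := h1.add (memLp_const (f x₀))
  rwa [show (fun y => T y - f x₀) + (fun _ => f x₀) = T by funext y; simp] at h2

theorem sq_absBias_add_var_eq_mse (hW : IsBrownianReal W P) {T : (I → ℝ) → ℝ} (hT : Measurable T)
    {f : ℝ → ℝ} (h : mse P W n x₀ T f ≠ ∞) :
    absBias P W n x₀ T f ^ 2 + var P W n T f = mse P W n x₀ T f := by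
  have := isProbabilityMeasure_law hW n f
  have hT2 := memLp_two_of_mse_ne_top hW hT h
  have hTi := hT2.integrable one_le_two
  set μ := law P W n f
  have h1 : mse P W n x₀ T f = ENNReal.ofReal (∫ y, (T y - f x₀) ^ 2 ∂μ) := by
    have hTf : MemLp (fun y => T y - f x₀) 2 μ := hT2.sub (memLp_const (f x₀))
    rw [ofReal_integral_eq_lintegral_ofReal hTf.integrable_sq
      (Eventually.of_forall fun y => sq_nonneg _), mse]
    refine lintegral_congr fun y => ?_
    rw [← ofReal_norm, ← ENNReal.ofReal_pow (norm_nonneg _), Real.norm_eq_abs, sq_abs]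
  have h2 : var P W n T f = ENNReal.ofReal Var[T; μ] := (ofReal_variance hT2).symm
  rw [h1, h2, absBias, ← ofReal_norm, ← ENNReal.ofReal_pow (norm_nonneg _), Real.norm_eq_abs,
    sq_abs, ← ENNReal.ofReal_add (sq_nonneg _) (variance_nonneg _ _)]
  congr 1
  rw [variance_eq_integral hT.aemeasurable]
  set E := ∫ y, T y ∂μ with hE
  have h3 : ∀ y, (T y - f x₀) ^ 2 =
      (T y - E) ^ 2 + (2 * (E - f x₀) * (T y - E) + (E - f x₀) ^ 2) := fun y => by ring
  have i1 : Integrable (fun y => (T y - E) ^ 2) μ := (hT2.sub (memLp_const E)).integrable_sq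
  have i2 : Integrable (fun y => 2 * (E - f x₀) * (T y - E)) μ :=
    (hTi.sub (integrable_const E)).const_mul _
  have i3 : Integrable (fun _ : I → ℝ => (E - f x₀) ^ 2) μ := integrable_const _
  have i4 : Integrable (fun y => 2 * (E - f x₀) * (T y - E) + (E - f x₀) ^ 2) μ := i2.add i3
  simp_rw [h3]
  rw [integral_add i1 i4, integral_add i2 i3, integral_const_mul,
    integral_sub hTi (integrable_const E), ← hE]
  simp
  ring

theorem sq_absBias_le_mse (hW : IsBrownianReal W P) {T : (I → ℝ) → ℝ} (hT : Measurable T)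
    (f : ℝ → ℝ) : absBias P W n x₀ T f ^ 2 ≤ mse P W n x₀ T f := by
  by_cases h : mse P W n x₀ T f = ∞
  · rw [h]; exact le_top
  · rw [← sq_absBias_add_var_eq_mse hW hT h]; exact le_self_add

theorem var_le_mse (hW : IsBrownianReal W P) {T : (I → ℝ) → ℝ} (hT : Measurable T)
    (f : ℝ → ℝ) : var P W n T f ≤ mse P W n x₀ T f := by
  by_cases h : mse P W n x₀ T f = ∞
  · rw [h]; exact le_top
  · rw [← sq_absBias_add_var_eq_mse hW hT h]; exact le_add_self

theorem absBias_le_rpow_half (hW : IsBrownianReal W P) {T : (I → ℝ) → ℝ} (hT : Measurable T)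
    {f : ℝ → ℝ} {M : ℝ≥0∞} (h : mse P W n x₀ T f ≤ M) :
    absBias P W n x₀ T f ≤ M ^ (1 / 2 : ℝ) := by
  have h1 := ENNReal.rpow_le_rpow ((sq_absBias_le_mse hW hT f).trans h)
    (by norm_num : (0 : ℝ) ≤ 1 / 2)
  rwa [← ENNReal.rpow_natCast, ← ENNReal.rpow_mul, Nat.cast_ofNat, mul_one_div_cancel two_ne_zero,
    ENNReal.rpow_one] at h1

theorem min_gamma_le_iSup_mse (hW : IsBrownianReal W P) (hβ : 0 < β) (hn : 0 < n)
    {T : (I → ℝ) → ℝ} (hT : Measurable T) :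
    min ((gamma R β / ENNReal.ofReal n) ^ (2 * β / (2 * β + 1))) 1 ≤
      ⨆ f ∈ holderBall β R, mse P W n x₀ T f := by
  set M := ⨆ f ∈ holderBall β R, mse P W n x₀ T f
  by_cases hM1 : 1 ≤ M
  · exact (min_le_right _ _).trans hM1
  push Not at hM1
  have hMt : M ≠ ∞ := (hM1.trans ENNReal.one_lt_top).ne
  have hmse : ∀ f ∈ holderBall β R, mse P W n x₀ T f ≤ M := fun f hf =>
    le_iSup₂ (f := fun f _ => mse P W n x₀ T f) f hf
  have hbias : (⨆ f ∈ holderBall β R, absBias P W n x₀ T f) ≤ M ^ (1 / 2 : ℝ) :=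
    iSup₂_le fun f hf => absBias_le_rpow_half hW hT (hmse f hf)
  -- A mean squared error below `1` forces square integrability and bias below `1`, so (i) applies;
  -- the minimum with `1` covers all other estimators.
  have hTT : T ∈ classT P W n β R x₀ := by
    refine ⟨⟨hT, fun f hf => ?_⟩, hbias.trans_lt (ENNReal.rpow_lt_one hM1 (by norm_num))⟩
    have := isProbabilityMeasure_law hW n f
    exact (memLp_two_of_mse_ne_top hW hT (ne_top_of_le_ne_top hMt (hmse f hf))).integrable
      one_le_two
  have key := gamma_div_le_mulTop hW hβ hn hTT
  have hF : (⨆ f ∈ holderBall β R, absBias P W n x₀ T f ^ (1 / β)) ≤ M ^ (1 / (2 * β)) := by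
    refine iSup₂_le fun f hf => ?_
    refine (ENNReal.rpow_le_rpow (absBias_le_rpow_half hW hT (hmse f hf))
      (by positivity : 0 ≤ 1 / β)).trans_eq ?_
    rw [← ENNReal.rpow_mul]
    congr 1
    field_simp
  have hS : (⨆ f ∈ holderBall β R, var P W n T f) ≤ M :=
    iSup₂_le fun f hf => (var_le_mse hW hT f).trans (hmse f hf)
  have hFt := ne_top_of_le_ne_top (ENNReal.rpow_ne_top_of_nonneg (by positivity) hMt) hF
  have hSt := ne_top_of_le_ne_top hMt hS
  rw [mulTop, if_neg (not_or.2 ⟨hFt, hSt⟩)] at key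
  have key2 : gamma R β / ENNReal.ofReal n ≤ M ^ ((2 * β + 1) / (2 * β)) := by
    refine key.trans ((mul_le_mul' hF hS).trans_eq ?_)
    have e : (2 * β + 1) / (2 * β) = 1 / (2 * β) + 1 := by field_simp; ring
    rw [e, ENNReal.rpow_add_of_nonneg _ _ (by positivity) zero_le_one, ENNReal.rpow_one]
  refine (min_le_left _ _).trans ((ENNReal.rpow_le_rpow key2 (by positivity)).trans_eq ?_)
  rw [← ENNReal.rpow_mul]
  have e : (2 * β + 1) / (2 * β) * (2 * β / (2 * β + 1)) = 1 := by field_simp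
  rw [e, ENNReal.rpow_one]

/-- Scaled form of the worst-case trade-off for one kernel. -/
theorem one_le_of_bias_le_of_var_le (hW : IsBrownianReal W P) (hβ : 0 < β) (hn : 0 < n)
    {K : ℝ → ℝ} (hK : K ∈ kernels β) (hK2 : eLpNorm K 2 volume ≠ ∞)
    {T : (I → ℝ) → ℝ} (hT : Measurable T) {V s t : ℝ} (hV : 0 < V)
    (hVR : ENNReal.ofReal V * holderNorm univ β K ≤ ENNReal.ofReal R) (hs : 0 ≤ s) (ht : 0 < t)
    (htV : 2 * (t * n ^ (-(β / (2 * β + 1)))) ≤ V)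
    (hbias : ∀ f ∈ holderBall β R,
      absBias P W n x₀ T f ≤ ENNReal.ofReal (t * n ^ (-(β / (2 * β + 1)))))
    (hvar : ∀ f ∈ holderBall β R,
      var P W n T f ≤ ENNReal.ofReal (s * n ^ (-(2 * β / (2 * β + 1))))) :
    1 ≤ 4 * (eLpNorm K 2 volume).toReal ^ 2 * s * (2 * t / V) ^ (1 / β) := by
  set L := (eLpNorm K 2 volume).toReal
  set b := t * n ^ (-(β / (2 * β + 1))) with hb
  have hb0 : 0 < b := by positivity
  -- This bandwidth makes the signal `V h^β` equal to twice the bias bound.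
  set h := (2 * b / V) ^ (1 / β) with hh
  have hh0 : 0 < h := by positivity
  have hh1 : h ≤ 1 := Real.rpow_le_one (by positivity) ((div_le_one hV).2 htV) (by positivity)
  have hhβ : h ^ β = 2 * b / V := by
    rw [hh, ← Real.rpow_mul (by positivity), one_div_mul_cancel hβ.ne', Real.rpow_one]
  have hVh : V * h ^ β = 2 * b := by rw [hhβ]; field_simp
  have key := sq_le_mul_of_var_le hW hβ hn hK hK2 hT hh0 hh1 hV hVR hb0.le
    (by rw [hVh]; linarith) (by positivity) hbias hvar
  have hpow : V ^ 2 * h ^ (2 * β + 1) = (V * h ^ β) ^ 2 * h := by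
    rw [Real.rpow_add hh0, Real.rpow_one, mul_comm 2 β, Real.rpow_mul hh0.le, Real.rpow_two]
    ring
  rw [hpow, hVh] at key
  have hscale : h = (2 * t / V) ^ (1 / β) * n ^ (-(1 / (2 * β + 1))) := by
    have e : 2 * b / V = 2 * t / V * n ^ (-(β / (2 * β + 1))) := by rw [hb]; ring
    rw [hh, e, Real.mul_rpow (by positivity) (by positivity), ← Real.rpow_mul hn.le]
    congr 2
    field_simp
  have hnn : n ^ (-(2 * β / (2 * β + 1))) * n * n ^ (-(1 / (2 * β + 1))) = 1 := by
    nth_rewrite 2 [← Real.rpow_one n]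
    rw [← Real.rpow_add hn, ← Real.rpow_add hn]
    have e : -(2 * β / (2 * β + 1)) + 1 + -(1 / (2 * β + 1)) = 0 := by field_simp; ring
    rw [e, Real.rpow_zero]
  have e1 : s * n ^ (-(2 * β / (2 * β + 1))) * (n * ((2 * b) ^ 2 * h * L ^ 2)) =
      4 * L ^ 2 * s * (2 * t / V) ^ (1 / β) * b ^ 2 *
        (n ^ (-(2 * β / (2 * β + 1))) * n * n ^ (-(1 / (2 * β + 1)))) := by
    rw [hscale]; ring
  rw [e1, hnn, mul_one] at key
  have e2 : (2 * b - b) ^ 2 = 1 * b ^ 2 := by ring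
  rw [e2] at key
  exact le_of_mul_le_mul_right key (by positivity)

theorem exists_balance (hW : IsBrownianReal W P) (hβ : 0 < β) (hR : 0 < R) {A : ℝ} (hA : 0 < A) :
    ∃ c : ℝ, 0 < c ∧ ∃ n₀ : ℝ, 0 < n₀ ∧
      ∀ n : ℝ, n₀ ≤ n → ∀ T : (I → ℝ) → ℝ, Measurable T →
        (⨆ f ∈ holderBall β R, mse P W n x₀ T f) ≤
            ENNReal.ofReal (A * n ^ (-(2 * β / (2 * β + 1)))) →
        ENNReal.ofReal (c * n ^ (-(2 * β / (2 * β + 1)))) ≤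
            (⨆ f ∈ holderBall β R, absBias P W n x₀ T f) ^ 2 ∧
          ENNReal.ofReal (c * n ^ (-(2 * β / (2 * β + 1)))) ≤
            ⨆ f ∈ holderBall β R, var P W n T f := by
  obtain ⟨K, hK, hK2⟩ := exists_mem_kernels_eLpNorm_ne_top hβ
  have hL := ENNReal.toReal_pos (eLpNorm_ne_zero_of_mem_kernels hK) hK2
  have hN := one_le_toReal_holderNorm hK
  set L := (eLpNorm K 2 volume).toReal
  have hN0 : 0 < (holderNorm univ β K).toReal := by linarith
  set V := R / (holderNorm univ β K).toReal with hVdef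
  have hV : 0 < V := div_pos hR hN0
  have hVR : ENNReal.ofReal V * holderNorm univ β K ≤ ENNReal.ofReal R := by
    rw [← ofReal_toReal_holderNorm hK, ← ENNReal.ofReal_mul hV.le, hVdef,
      div_mul_cancel₀ _ hN0.ne']
  -- Solves `4 L² A (2t/V)^(1/β) = 1/2`: with variance at scale `A`, a bias at scale `t` is
  -- impossible. Below, `s` is the corresponding variance scale when the bias is at scale `√A`.
  set t := V / 2 * (1 / (8 * L ^ 2 * A)) ^ β with htdef
  have ht : 0 < t := by positivity
  have htA : 4 * L ^ 2 * A * (2 * t / V) ^ (1 / β) < 1 := by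
    have e : 2 * t / V = (1 / (8 * L ^ 2 * A)) ^ β := by rw [htdef]; field_simp
    rw [e, ← Real.rpow_mul (by positivity), mul_one_div_cancel hβ.ne', Real.rpow_one]
    have : 4 * L ^ 2 * A * (1 / (8 * L ^ 2 * A)) = 1 / 2 := by field_simp; norm_num
    rw [this]; norm_num
  set q := (2 * √A / V) ^ (1 / β)
  have hsA : 0 < √A := Real.sqrt_pos.2 hA
  have hq : 0 < q := by positivity
  set s := 1 / (8 * L ^ 2 * q) with hsdef
  have hs : 0 < s := by positivity
  have hsq : 4 * L ^ 2 * s * q < 1 := by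
    have : 4 * L ^ 2 * s * q = 1 / 2 := by rw [hsdef]; field_simp; norm_num
    rw [this]; norm_num
  -- Large `n` ensures that the signal scale `2b` is at most `V`, so the bandwidth is at most `1`,
  -- for either choice of `t`.
  have hlim : Tendsto (fun n : ℝ => 2 * (max t √A * n ^ (-(β / (2 * β + 1))))) atTop
      (𝓝 (2 * (max t √A * 0))) :=
    ((tendsto_rpow_neg_atTop (by positivity)).const_mul _).const_mul _
  rw [mul_zero, mul_zero] at hlim
  obtain ⟨n₁, hn₁⟩ := eventually_atTop.1 (hlim.eventually (gt_mem_nhds hV))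
  refine ⟨min (t ^ 2) s, by positivity, max n₁ 1, by positivity, fun n hn T hT hmse => ?_⟩
  have hn0 : 0 < n := lt_of_lt_of_le (by positivity) hn
  have hnV := (hn₁ n ((le_max_left _ _).trans hn)).le
  have hrt : ∀ u : ℝ, 0 ≤ u → ENNReal.ofReal (u ^ 2 * n ^ (-(2 * β / (2 * β + 1)))) =
      ENNReal.ofReal (u * n ^ (-(β / (2 * β + 1)))) ^ 2 := fun u hu => by
    rw [← ENNReal.ofReal_pow (by positivity), mul_pow, ← Real.rpow_natCast (n ^ _),
      ← Real.rpow_mul hn0.le]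
    congr 3
    push_cast
    ring
  have hle : ∀ f ∈ holderBall β R,
      mse P W n x₀ T f ≤ ENNReal.ofReal (A * n ^ (-(2 * β / (2 * β + 1)))) := fun f hf =>
    (le_iSup₂ (f := fun f _ => mse P W n x₀ T f) f hf).trans hmse
  constructor
  · by_contra! hc
    have hB : (⨆ f ∈ holderBall β R, absBias P W n x₀ T f) ≤
        ENNReal.ofReal (t * n ^ (-(β / (2 * β + 1)))) := by
      have h1 := hc.le.trans (ENNReal.ofReal_le_ofReal (mul_le_mul_of_nonneg_right
        (min_le_left (t ^ 2) s) (Real.rpow_nonneg hn0.le _)))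
      rw [hrt t ht.le] at h1
      exact (ENNReal.pow_le_pow_left_iff two_ne_zero).1 h1
    refine absurd (one_le_of_bias_le_of_var_le hW hβ hn0 hK hK2 hT hV hVR hA.le ht ?_
      (fun f hf => (le_iSup₂ (f := fun f _ => absBias P W n x₀ T f) f hf).trans hB)
      (fun f hf => (var_le_mse hW hT f).trans (hle f hf))) (not_le.2 htA)
    refine le_trans ?_ hnV
    gcongr
    exact le_max_left _ _
  · by_contra! hc
    refine absurd (one_le_of_bias_le_of_var_le hW hβ hn0 hK hK2 hT (x₀ := x₀) hV hVR hs.le hsA ?_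
      (fun f hf => ?_) (fun f hf => ?_)) (not_le.2 hsq)
    · refine le_trans ?_ hnV
      gcongr
      exact le_max_right _ _
    · have h1 := (sq_absBias_le_mse hW hT f).trans (hle f hf)
      rw [← Real.sq_sqrt hA.le, hrt _ hsA.le] at h1
      exact (ENNReal.pow_le_pow_left_iff two_ne_zero).1 h1
    · refine (le_iSup₂ (f := fun f _ => var P W n T f) f hf).trans (hc.le.trans ?_)
      gcongr
      exact min_le_right _ _

end TradeOff

end WhiteNoise

end

theorem theorem3p1 {Ω : Type*} [MeasurableSpace Ω] (P : Measure Ω) (W : ℝ≥0 → Ω → ℝ)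
    (hW : IsBrownianReal W P) (β R x₀ : ℝ) (hβ : 0 < β) (hR : 0 < R) (hx₀ : x₀ ∈ Icc (0 : ℝ) 1) :
    -- worst-case bias-variance trade-off
    (∀ n : ℝ, 0 < n →
      WhiteNoise.gamma R β / ENNReal.ofReal n ≤
        ⨅ T ∈ WhiteNoise.classT P W n β R x₀,
          WhiteNoise.mulTop
            (⨆ f ∈ WhiteNoise.holderBall β R, WhiteNoise.absBias P W n x₀ T f ^ (1 / β))
            (⨆ f ∈ WhiteNoise.holderBall β R, WhiteNoise.var P W n T f)) ∧
    -- lower bound on the variance at every parameter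
    (∀ n : ℝ, 0 < n → ∀ C : ℝ, 0 < C →
      1 / ENNReal.ofReal n ≤
        ⨅ T ∈ WhiteNoise.classS P W n β R x₀ C,
          WhiteNoise.mulTop
            (⨆ f ∈ WhiteNoise.holderBall β R, WhiteNoise.absBias P W n x₀ T f ^ (1 / β))
            (⨅ f ∈ WhiteNoise.holderBall β R,
              WhiteNoise.divTop (WhiteNoise.var P W n T f)
                (WhiteNoise.gammaBar R β C (WhiteNoise.holderNorm (Icc 0 1) β f).toReal))) ∧
    -- minimax lower bound, over all measurable estimators
    (∀ n : ℝ, 0 < n →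
      min ((WhiteNoise.gamma R β / ENNReal.ofReal n) ^ (2 * β / (2 * β + 1))) 1 ≤
        ⨅ T ∈ {T : (I → ℝ) → ℝ | Measurable T},
          ⨆ f ∈ WhiteNoise.holderBall β R, WhiteNoise.mse P W n x₀ T f) ∧
    -- estimators attaining the minimax rate balance worst-case squared bias and variance
    (∀ A : ℝ, 0 < A → ∃ c : ℝ, 0 < c ∧ ∃ n₀ : ℝ, 0 < n₀ ∧
      ∀ n : ℝ, n₀ ≤ n → ∀ T : (I → ℝ) → ℝ, Measurable T →
        (⨆ f ∈ WhiteNoise.holderBall β R, WhiteNoise.mse P W n x₀ T f) ≤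
            ENNReal.ofReal (A * n ^ (-(2 * β / (2 * β + 1)))) →
        ENNReal.ofReal (c * n ^ (-(2 * β / (2 * β + 1)))) ≤
            (⨆ f ∈ WhiteNoise.holderBall β R, WhiteNoise.absBias P W n x₀ T f) ^ 2 ∧
          ENNReal.ofReal (c * n ^ (-(2 * β / (2 * β + 1)))) ≤
            ⨆ f ∈ WhiteNoise.holderBall β R, WhiteNoise.var P W n T f) := by
  exact ⟨fun n hn => le_iInf₂ fun T hT => WhiteNoise.gamma_div_le_mulTop hW hβ hn hT,
    fun n hn C hC => le_iInf₂ fun T hT => WhiteNoise.one_div_le_mulTop hW hβ hn hC hT,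
    fun n hn => le_iInf₂ fun T hT => WhiteNoise.min_gamma_le_iSup_mse hW hβ hn hT,
    fun A hA => WhiteNoise.exists_balance hW hβ hR hA⟩
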